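/- Let $X$ be a smooth manifold of dimension $n$ and let $K_1,\dots,K_n$ be smooth, pairwise commuting operator fields (that is, $(1,1)$-tensor fields) on $X$ that span an operator Frobenius algebra: at every point $x\in X$ there is $\xi\in T_xX$ such that $K_1\xi,\dots,K_n\xi$ are linearly independent, and there is $\alpha\in T_x^*X$ such that $K_1^*\alpha,\dots,K_n^*\alpha$ are linearly independent. Then $K_iK_j=\sum_k a_{ij}^kK_k$ with uniquely determined smooth functions $a_{ij}^k$. Let $a_1,\dots,a_n\in\mathbb R$ be constants such that the matrix $b_{ij}(x)=\sum_k a_{ij}^k(x)\,a_k$ is non-degenerate at every $x\in X$, let $(b^{ij})$ be its inverse, and let $M^i=\sum_j b^{ij}K_j$ be the dual basis. For commuting operator fields $L,N$ put $\langle L,N\rangle(\xi,\eta)=LN[\xi,\eta]+[L\xi,N\eta]-L[\xi,N\eta]-N[L\xi,\eta]$. Smooth commuting operator fields $L,N$ are called symmetries of each other if the symmetric part of the tensor field $\langle L,N\rangle$ vanishes. A closed $1$-form $\alpha$ is called a conservation law of $L$ if $L^*\alpha=\alpha\circ L$ is closed. "Common" means: for every operator field of the family. The $K_i$ and $M^i$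 are defined on all of $X$; statements (2) and (3) hold on every open subset $U\subseteq X$, and all functions in them are smooth. Assume that $K_1,\dots,K_n$ are symmetries of each other. Then: (1) $M^1,\dots,M^n$ are smooth and are symmetries of each other. (2) For functions $h^1,\dots,h^n$ on $U$ and $h=\sum_s a_sh^s$, the operator field $K=\sum_i h^iK_i$ is a common symmetry of $K_1,\dots,K_n$ on $U$ if and only if $\mathrm dh$ is a common conservation law of $M^1,\dots,M^n$ on $U$ with $M^{i*}\mathrm dh=\mathrm dh^i$ for all $i$. Moreover, for a function $f$ on $U$, $\mathrm df$ is a common conservation law of $M^1,\dots,M^n$ if and only if it arises in this way locally: every point of $U$ has an open neighbourhood with functions $h^1,\dots,h^n$ on it such that $\mathrm df=\mathrm d\big(\sum_s a_sh^s\big)$, $M^{i*}\mathrm df=\mathrm dh^i$ for all $i$, and $\sum_i h^iK_i$ is a common symmetry of $K_1,\dots,K_n$ on it. (3) Suppose in addition that $\mathrm{Id}=\sum_i\beta^iK_i$ with constants $\beta^i\in\mathbb R$. Then, for a function $f$ on $U$, $\mathrm df$ is a common conservation law of $K_1,\dots,K_n$ if and only if every point of $U$ has an open neighbourhood with functions $f_1,\dots,f_n$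 on it such that $K_i^*\mathrm df=\mathrm df_i$ for all $i$ and $M=\sum_i f_iM^i$ is a common symmetry of $M^1,\dots,M^n$ on it. Moreover, whenever functions $f,f_1,\dots,f_n$ on $U$ satisfy $K_i^*\mathrm df=\mathrm df_i$ for all $i$, the operator field $\sum_i f_iM^i$ is a common symmetry of $M^1,\dots,M^n$ on $U$; and conversely, whenever $\sum_i f_iM^i$ is a common symmetry of $M^1,\dots,M^n$ on $U$, the form $\mathrm df$ with $f=\sum_i\beta^if_i$ is a common conservation law of $K_1,\dots,K_n$ on $U$ and $K_i^*\mathrm df=\mathrm df_i$ for all $i$. -/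

import Mathlib

open Bundle Set
open scoped Manifold ContDiff Topology

noncomputable section

namespace OperatorFrobenius

variable {n : ℕ} {X : Type*} [TopologicalSpace X] [ChartedSpace (EuclideanSpace ℝ (Fin n)) X]

/-- A vector field on the `n`-dimensional manifold `X` (no regularity is built in). -/
abbrev VField (n : ℕ) (X : Type*) [TopologicalSpace X]
    [ChartedSpace (EuclideanSpace ℝ (Fin n)) X] :=
  ∀ x : X, TangentSpace (𝓡 n) x

/-- An operator field on `X`, that is, a `(1,1)`-tensor field (no regularity is built in). -/
abbrev OpField (n : ℕ) (X : Type*) [TopologicalSpace X]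
    [ChartedSpace (EuclideanSpace ℝ (Fin n)) X] :=
  ∀ x : X, TangentSpace (𝓡 n) x →L[ℝ] TangentSpace (𝓡 n) x

/-- A `1`-form on `X` (no regularity is built in). -/
abbrev OneForm (n : ℕ) (X : Type*) [TopologicalSpace X]
    [ChartedSpace (EuclideanSpace ℝ (Fin n)) X] :=
  ∀ x : X, TangentSpace (𝓡 n) x →L[ℝ] ℝ

/-- The vector field `ξ` is smooth on `U`. -/
def SmoothVFieldOn [IsManifold (𝓡 n) ∞ X] (U : Set X) (ξ : VField n X) : Prop :=
  ContMDiffOn (𝓡 n) (𝓡 n).tangent ∞ (fun x => (⟨x, ξ x⟩ : TangentBundle (𝓡 n) X)) U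

/-- The function `f` is smooth on `U`. -/
def SmoothFunOn (n : ℕ) {X : Type*} [TopologicalSpace X]
    [ChartedSpace (EuclideanSpace ℝ (Fin n)) X] (U : Set X) (f : X → ℝ) : Prop :=
  ContMDiffOn (𝓡 n) 𝓘(ℝ, ℝ) ∞ f U

/-- The operator field `L` is smooth on `U`, as a section of the bundle `Hom(TX, TX)`. -/
def SmoothOpFieldOn [IsManifold (𝓡 n) ∞ X] (U : Set X) (L : OpField n X) : Prop :=
  ContMDiffOn (𝓡 n)
    ((𝓡 n).prod 𝓘(ℝ, EuclideanSpace ℝ (Fin n) →L[ℝ] EuclideanSpace ℝ (Fin n))) ∞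
    (fun x => TotalSpace.mk' (EuclideanSpace ℝ (Fin n) →L[ℝ] EuclideanSpace ℝ (Fin n))
      (E := fun y : X => TangentSpace (𝓡 n) y →L[ℝ] TangentSpace (𝓡 n) y) x (L x)) U

/-- The commutator `[ξ, η]` of two vector fields. -/
def bracket (ξ η : VField n X) : VField n X := VectorField.mlieBracket (𝓡 n) ξ η

/-- The vector field `L ξ`. -/
def applyOp (L : OpField n X) (ξ : VField n X) : VField n X := fun x => L x (ξ x)

/-- The expression
`⟨L, N⟩(ξ, η) = L N [ξ, η] + [L ξ, N η] - L [ξ, N η] - N [L ξ, η]`. -/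
def bracketTensor (L N : OpField n X) (ξ η : VField n X) : VField n X := fun x =>
  L x (N x (bracket ξ η x)) + bracket (applyOp L ξ) (applyOp N η) x
    - L x (bracket ξ (applyOp N η) x) - N x (bracket (applyOp L ξ) η x)

/-- The smooth operator fields `L` and `N` are symmetries of each other on the open set `U`: they
commute, and the symmetric part of `⟨L, N⟩` vanishes.  As `⟨L, N⟩` is a tensor field when `L` and
`N` commute, it is evaluated on all pairs of vector fields that are defined and smooth on some open
subset of `U`. -/
structure IsSymmetryOn [IsManifold (𝓡 n) ∞ X] (U : Set X) (L N : OpField n X) : Prop where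
  smooth_left : SmoothOpFieldOn U L
  smooth_right : SmoothOpFieldOn U N
  commute : ∀ x ∈ U, (L x).comp (N x) = (N x).comp (L x)
  symm_part : ∀ V : Set X, IsOpen V → V ⊆ U → ∀ ξ η : VField n X,
    SmoothVFieldOn V ξ → SmoothVFieldOn V η →
      ∀ x ∈ V, bracketTensor L N ξ η x + bracketTensor L N η ξ x = 0

/-- The operator fields `K 1, …, K n` are symmetries of each other on `U`. -/
def MutualSymmetriesOn [IsManifold (𝓡 n) ∞ X] (U : Set X) (K : Fin n → OpField n X) : Prop :=
  ∀ i j, IsSymmetryOn U (K i) (K j)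

/-- `L` is a common symmetry of `K 1, …, K n` on `U`. -/
def IsCommonSymmetryOn [IsManifold (𝓡 n) ∞ X] (U : Set X) (K : Fin n → OpField n X)
    (L : OpField n X) : Prop :=
  ∀ i, IsSymmetryOn U (K i) L

/-- The differential `d f : ξ ↦ ξ(f)` of a function. -/
def differential (n : ℕ) {X : Type*} [TopologicalSpace X]
    [ChartedSpace (EuclideanSpace ℝ (Fin n)) X] (f : X → ℝ) : OneForm n X :=
  fun x => mvfderiv (𝓡 n) f x

/-- The `1`-form `L^* α`, given by `(L^* α)(ξ) = α(L ξ)`. -/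
def pullForm (L : OpField n X) (α : OneForm n X) : OneForm n X := fun x => (α x).comp (L x)

/-- The exterior derivative of a `1`-form,
`dα(ξ, η) = ξ(α(η)) - η(α(ξ)) - α([ξ, η])`, as a function on `X`. -/
def extDerivForm (α : OneForm n X) (ξ η : VField n X) : X → ℝ := fun x =>
  differential n (fun y => α y (η y)) x (ξ x) - differential n (fun y => α y (ξ y)) x (η x)
    - α x (bracket ξ η x)

/-- The (smooth) `1`-form `α` is closed on the open set `U`. -/
def IsClosedFormOn [IsManifold (𝓡 n) ∞ X] (U : Set X) (α : OneForm n X) : Prop :=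
  ∀ V : Set X, IsOpen V → V ⊆ U → ∀ ξ η : VField n X,
    SmoothVFieldOn V ξ → SmoothVFieldOn V η → ∀ x ∈ V, extDerivForm α ξ η x = 0

/-- `α` is a conservation law of `L` on `U`: both `α` and `L^* α` are closed. -/
def IsConservationLawOn [IsManifold (𝓡 n) ∞ X] (U : Set X) (L : OpField n X) (α : OneForm n X) : Prop :=
  IsClosedFormOn U α ∧ IsClosedFormOn U (pullForm L α)

/-- The `1`-form `α` is a common conservation law of `K 1, …, K n` on `U`. -/
def IsCommonConservationLawOn [IsManifold (𝓡 n) ∞ X] (U : Set X)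
    (K : Fin n → OpField n X) (α : OneForm n X) : Prop :=
  ∀ i, IsConservationLawOn U (K i) α

/-- The combination `h 1 • K 1 + ⋯ + h n • K n` with functional coefficients. -/
def combination (h : Fin n → X → ℝ) (K : Fin n → OpField n X) : OpField n X :=
  fun x => ∑ i, h i x • K i x

/-- `K 1, …, K n` span an operator Frobenius algebra on the `n`-dimensional manifold `X`: they are
smooth and commute, and at every point `x` the conditions (A1) and (A2) hold, that is,
`K 1 ξ, …, K n ξ` are linearly independent for some `ξ ∈ T_x X`, and `K 1^* α, …, K n^* α` are
linearly independent for some `α ∈ T_x^* X`.  It follows that the span of `K 1 (x), …, K n (x)` is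
an `n`-dimensional unital subalgebra of `End (T_x X)`. -/
structure IsOperatorFrobeniusAlgebra [IsManifold (𝓡 n) ∞ X] (K : Fin n → OpField n X) :
    Prop where
  smooth : ∀ i, SmoothOpFieldOn univ (K i)
  commute : ∀ i j x, (K i x).comp (K j x) = (K j x).comp (K i x)
  exists_generic_vector : ∀ x, ∃ ξ : TangentSpace (𝓡 n) x,
    LinearIndependent ℝ (fun i => K i x ξ)
  exists_generic_covector : ∀ x, ∃ α : TangentSpace (𝓡 n) x →L[ℝ] ℝ,
    LinearIndependent ℝ (fun i => α.comp (K i x))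

/-- The structure functions: `k ↦ structureFun K i j x k` is the coefficient vector with
`K i (x) K j (x) = ∑ k, a_{ij}^k (x) K k (x)`.  For an operator Frobenius algebra it exists and is
unique. -/
def structureFun (K : Fin n → OpField n X) (i j : Fin n) (x : X) : Fin n → ℝ :=
  Classical.epsilon fun c : Fin n → ℝ => (K i x).comp (K j x) = ∑ k, c k • K k x

/-- The matrix `b_{ij}(x) = ∑ k, a_{ij}^k (x) a_k` of the form `b_a` in the basis `K 1, …, K n`. -/
def frobeniusForm (K : Fin n → OpField n X) (a : Fin n → ℝ) (x : X) :
    Matrix (Fin n) (Fin n) ℝ :=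
  Matrix.of fun i j => ∑ k, structureFun K i j x k * a k

/-- The dual basis `M^i = ∑ j, b^{ij} K_j` with respect to `b_a`, where `(b^{ij})` is the inverse
of the matrix `(b_{ij})`. -/
def dualBasis (K : Fin n → OpField n X) (a : Fin n → ℝ) (i : Fin n) : OpField n X :=
  fun x => ∑ j, (frobeniusForm K a x)⁻¹ i j • K j x

end OperatorFrobenius

end

open OperatorFrobenius

/-! By polarization, two commuting smooth fields are symmetries of each other exactly when `⟨L,
N⟩(ξ, ξ) = 0` for all local smooth `ξ`. On the diagonal the Leibniz rule gives `⟨L, ∑ h^j K_j⟩(ξ, ξ)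
= ∑ h^j ⟨L, K_j⟩(ξ, ξ) + ∑ (dh^j(Lξ) K_j ξ - dh^j(ξ) L K_j ξ)`, so among symmetries of `L` only a
term algebraic in the `dh^j` survives (`bracketTensor_combination_of_isSymmetryOn`). For `L = K_i` a
cyclic vector turns its vanishing into the linear system `K_i^* dh^k = ∑ a_{ij}^k dh^j`.

Statement (2) is then linear algebra at a point plus the Poincaré lemma. Associativity makes `b`
invariant, hence `K_p M^s = ∑ a_{pl}^s M^l` (`comp_dual`), and with this the system is equivalent to
`M^{i*} (∑ a_s dh^s) = dh^i` (`comp_eq_sum_iff_dual`). Conversely, potentials `h^i` of the closed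
forms `M^{i*} df` satisfy `df = ∑ a_s dh^s`, because `Id = ∑ a_s M^s` (`id_eq_sum_smul_dual`).

For (1), `⟨K_p, K_r K_l⟩(ξ, ξ) = ⟨K_p, K_r⟩(ξ, K_l ξ) + K_r ⟨K_p, K_l⟩(ξ, ξ)`, and `⟨K_p, K_r⟩ =
⟨K_r, K_p⟩` for symmetries. Expanding `K_r K_l` in the basis gives a differential identity for the
`a_{rl}^k`, symmetric in `p, r`. Differentiated associativity moves the summation so that the index
`k` can be contracted with the constants `a_k`, which leaves an identity for `db`
(`differential_frobeniusForm_symm`). It says that the derivative terms `W p r` of `⟨K_p, ∑ b_{rs}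
M^s⟩(ξ, ξ)` are symmetric in `p, r`, while `⟨M^i, M^j⟩(ξ, ξ)` is an antisymmetrized contraction of
`W` (`dual_variation_eq_zero`).

For (3), if `Id = ∑ β^i K_i` with constant `β`, then the form that `β` defines in the basis `M^i`
has matrix `b^{-1}`, so the dual basis of `M` with respect to `β` is `K` again, and (2) applies to
`M`. -/

namespace OperatorFrobenius

/-! ### Calculus of functions, vector fields and operator fields on open sets. -/

section Calculus

variable {n : ℕ} {X : Type*} [TopologicalSpace X] [ChartedSpace (EuclideanSpace ℝ (Fin n)) X]

lemma SmoothFunOn.mono {U V : Set X} {f : X → ℝ} (hf : SmoothFunOn n U f) (h : V ⊆ U) :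
    SmoothFunOn n V f := ContMDiffOn.mono hf h

lemma SmoothFunOn.mdifferentiableAt {U : Set X} {f : X → ℝ} (hf : SmoothFunOn n U f)
    (hU : IsOpen U) {x : X} (hx : x ∈ U) : MDifferentiableAt (𝓡 n) 𝓘(ℝ, ℝ) f x :=
  (ContMDiffOn.contMDiffAt hf (hU.mem_nhds hx)).mdifferentiableAt (by simp)

lemma differential_congr {f g : X → ℝ} {x : X} (h : f =ᶠ[𝓝 x] g) :
    differential n f x = differential n g x := by
  have e : mfderiv (𝓡 n) 𝓘(ℝ, ℝ) f x = mfderiv (𝓡 n) 𝓘(ℝ, ℝ) g x := h.mfderiv_eq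
  ext v
  exact congrArg (fun L : EuclideanSpace ℝ (Fin n) →L[ℝ] ℝ => L v) e

lemma differential_const (c : ℝ) (x : X) : differential n (fun _ : X => c) x = 0 :=
  mvfderiv_const c

lemma differential_add {f g : X → ℝ} {x : X} (hf : MDifferentiableAt (𝓡 n) 𝓘(ℝ, ℝ) f x)
    (hg : MDifferentiableAt (𝓡 n) 𝓘(ℝ, ℝ) g x) :
    differential n (fun y => f y + g y) x = differential n f x + differential n g x :=
  mvfderiv_add hf hg

lemma differential_mul {f g : X → ℝ} {x : X} (hf : MDifferentiableAt (𝓡 n) 𝓘(ℝ, ℝ) f x)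
    (hg : MDifferentiableAt (𝓡 n) 𝓘(ℝ, ℝ) g x) :
    differential n (fun y => f y * g y) x = f x • differential n g x + g x • differential n f x := by
  have := mvfderiv_mul hf hg
  exact this

lemma differential_sum {ι : Type*} (s : Finset ι) {f : ι → X → ℝ} {x : X}
    (hf : ∀ i ∈ s, MDifferentiableAt (𝓡 n) 𝓘(ℝ, ℝ) (f i) x) :
    differential n (fun y => ∑ i ∈ s, f i y) x = ∑ i ∈ s, differential n (f i) x := by
  classical
  have key : MDifferentiableAt (𝓡 n) 𝓘(ℝ, ℝ) (fun y => ∑ i ∈ s, f i y) x ∧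
      differential n (fun y => ∑ i ∈ s, f i y) x = ∑ i ∈ s, differential n (f i) x := by
    induction s using Finset.induction_on with
    | empty => exact ⟨by simpa using mdifferentiableAt_const, by simpa using differential_const 0 x⟩
    | insert i s hi ih =>
      obtain ⟨h1, h2⟩ := ih fun j hj => hf j (Finset.mem_insert_of_mem hj)
      have h3 := hf i (Finset.mem_insert_self i s)
      simp only [Finset.sum_insert hi]
      exact ⟨h3.add h1, by rw [differential_add h3 h1, h2]⟩
  exact key.2

lemma differential_sum_mul {ι : Type*} [Fintype ι] {f g : ι → X → ℝ} {x : X}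
    (hf : ∀ i, MDifferentiableAt (𝓡 n) 𝓘(ℝ, ℝ) (f i) x)
    (hg : ∀ i, MDifferentiableAt (𝓡 n) 𝓘(ℝ, ℝ) (g i) x) (v : TangentSpace (𝓡 n) x) :
    differential n (fun y => ∑ i, f i y * g i y) x v =
      ∑ i, (f i x * differential n (g i) x v + g i x * differential n (f i) x v) := by
  rw [differential_sum (f := fun i y => f i y * g i y) _ fun i _ => (hf i).mul (hg i), sum_apply]
  refine Finset.sum_congr rfl fun i _ => ?_
  rw [differential_mul (hf i) (hg i)]
  rfl

lemma differential_const_mul (c : ℝ) {f : X → ℝ} {x : X}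
    (hf : MDifferentiableAt (𝓡 n) 𝓘(ℝ, ℝ) f x) :
    differential n (fun y => c * f y) x = c • differential n f x := by
  rw [differential_mul mdifferentiableAt_const hf, differential_const]
  simp

lemma differential_linearCombination {ι : Type*} [Fintype ι] (a : ι → ℝ) {f : ι → X → ℝ} {x : X}
    (hf : ∀ i, MDifferentiableAt (𝓡 n) 𝓘(ℝ, ℝ) (f i) x) :
    differential n (fun y => ∑ i, a i * f i y) x = ∑ i, a i • differential n (f i) x := by
  rw [differential_sum _ fun i _ => ?_]
  · exact Finset.sum_congr rfl fun i _ => differential_const_mul _ (hf i)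
  · exact mdifferentiableAt_const.mul (hf i)

lemma bracket_swap (ξ η : VField n X) (x : X) : bracket ξ η x = -bracket η ξ x :=
  VectorField.mlieBracket_swap_apply

lemma bracket_self (ξ : VField n X) (x : X) : bracket ξ ξ x = 0 := by
  simp [bracket]

lemma bracket_zero_right (ξ : VField n X) (x : X) : bracket ξ (fun _ => 0) x = 0 :=
  congrFun (VectorField.mlieBracket_zero_right (I := 𝓡 n) (W := ξ)) x

lemma bracket_congr {ξ ξ' η η' : VField n X} {x : X} (h : ∀ᶠ y in 𝓝 x, ξ y = ξ' y)
    (h' : ∀ᶠ y in 𝓝 x, η y = η' y) : bracket ξ η x = bracket ξ' η' x :=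
  Filter.EventuallyEq.mlieBracket_vectorField_eq h h'

variable [IsManifold (𝓡 n) ∞ X]

lemma SmoothVFieldOn.mono {U V : Set X} {ξ : VField n X} (hξ : SmoothVFieldOn U ξ) (h : V ⊆ U) :
    SmoothVFieldOn V ξ := ContMDiffOn.mono hξ h

lemma SmoothOpFieldOn.mono {U V : Set X} {L : OpField n X} (hL : SmoothOpFieldOn U L) (h : V ⊆ U) :
    SmoothOpFieldOn V L := ContMDiffOn.mono hL h

lemma SmoothVFieldOn.mdifferentiableAt {U : Set X} {ξ : VField n X} (hξ : SmoothVFieldOn U ξ)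
    (hU : IsOpen U) {x : X} (hx : x ∈ U) :
    MDifferentiableAt (𝓡 n) (𝓡 n).tangent (fun x => (⟨x, ξ x⟩ : TangentBundle (𝓡 n) X)) x :=
  (ContMDiffOn.contMDiffAt hξ (hU.mem_nhds hx)).mdifferentiableAt (by simp)

lemma SmoothOpFieldOn.applyOp {U : Set X} {L : OpField n X} {ξ : VField n X}
    (hL : SmoothOpFieldOn U L) (hξ : SmoothVFieldOn U ξ) : SmoothVFieldOn U (applyOp L ξ) :=
  ContMDiffOn.clm_bundle_apply (E₁ := fun x : X => TangentSpace (𝓡 n) x)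
    (E₂ := fun x : X => TangentSpace (𝓡 n) x) hL hξ

lemma SmoothVFieldOn.smul {U : Set X} {f : X → ℝ} {ξ : VField n X} (hf : SmoothFunOn n U f)
    (hξ : SmoothVFieldOn U ξ) : SmoothVFieldOn U (fun x => f x • ξ x) :=
  ContMDiffOn.smul_section (V := fun x : X => TangentSpace (𝓡 n) x) hf hξ

lemma SmoothVFieldOn.add {U : Set X} {ξ η : VField n X} (hξ : SmoothVFieldOn U ξ)
    (hη : SmoothVFieldOn U η) : SmoothVFieldOn U (fun x => ξ x + η x) :=
  ContMDiffOn.add_section (V := fun x : X => TangentSpace (𝓡 n) x) hξ hη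

lemma SmoothVFieldOn.sum {ι : Type*} {s : Finset ι} {U : Set X} {ξ : ι → VField n X}
    (hξ : ∀ i ∈ s, SmoothVFieldOn U (ξ i)) : SmoothVFieldOn U (fun x => ∑ i ∈ s, ξ i x) :=
  ContMDiffOn.sum_section (V := fun x : X => TangentSpace (𝓡 n) x) hξ

lemma smoothOpFieldOn_combination {U : Set X} {h : Fin n → X → ℝ} {K : Fin n → OpField n X}
    (hh : ∀ i, SmoothFunOn n U (h i)) (hK : ∀ i, SmoothOpFieldOn U (K i)) :
    SmoothOpFieldOn U (combination h K) :=
  ContMDiffOn.sum_section (V := fun x : X => TangentSpace (𝓡 n) x →L[ℝ] TangentSpace (𝓡 n) x)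
    fun i _ => ContMDiffOn.smul_section
      (V := fun x : X => TangentSpace (𝓡 n) x →L[ℝ] TangentSpace (𝓡 n) x) (hh i) (hK i)

/-- The bridge from identities between vector fields to identities between tensors at a point. A
local extension suffices because symmetry and closedness are tested on all open subsets. -/
lemma exists_smoothVField_eq {U : Set X} (hU : IsOpen U) {x : X} (hx : x ∈ U)
    (v : TangentSpace (𝓡 n) x) :
    ∃ V : Set X, IsOpen V ∧ x ∈ V ∧ V ⊆ U ∧ ∃ ξ : VField n X, SmoothVFieldOn V ξ ∧ ξ x = v := by
  obtain ⟨s, hs, h⟩ := FiberBundle.exists_contMDiffOn_extend (k := ∞) (𝓡 n)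
    (EuclideanSpace ℝ (Fin n)) (V := fun x : X => TangentSpace (𝓡 n) x) v
  obtain ⟨t, hts, ht, hxt⟩ := mem_nhds_iff.1 hs
  refine ⟨t ∩ U, ht.inter hU, ⟨hxt, hx⟩, inter_subset_right, _,
    ContMDiffOn.mono h (inter_subset_left.trans hts), ?_⟩
  simp

variable {U : Set X}

lemma bracket_add_right (hU : IsOpen U) {ξ η ζ : VField n X} (hη : SmoothVFieldOn U η)
    (hζ : SmoothVFieldOn U ζ) {x : X} (hx : x ∈ U) :
    bracket ξ (fun y => η y + ζ y) x = bracket ξ η x + bracket ξ ζ x :=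
  VectorField.mlieBracket_add_right (hη.mdifferentiableAt hU hx) (hζ.mdifferentiableAt hU hx)

lemma bracket_add_left (hU : IsOpen U) {ξ η ζ : VField n X} (hξ : SmoothVFieldOn U ξ)
    (hη : SmoothVFieldOn U η) {x : X} (hx : x ∈ U) :
    bracket (fun y => ξ y + η y) ζ x = bracket ξ ζ x + bracket η ζ x :=
  VectorField.mlieBracket_add_left (hξ.mdifferentiableAt hU hx) (hη.mdifferentiableAt hU hx)

lemma bracket_smul_right (hU : IsOpen U) {f : X → ℝ} {ξ η : VField n X} (hf : SmoothFunOn n U f)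
    (hη : SmoothVFieldOn U η) {x : X} (hx : x ∈ U) :
    bracket ξ (fun y => f y • η y) x = differential n f x (ξ x) • η x + f x • bracket ξ η x :=
  VectorField.mlieBracket_smul_right (hf.mdifferentiableAt hU hx) (hη.mdifferentiableAt hU hx)

lemma bracket_sum_right {ι : Type*} (s : Finset ι) (hU : IsOpen U) {ξ : VField n X}
    {η : ι → VField n X} (hη : ∀ i ∈ s, SmoothVFieldOn U (η i)) {x : X} (hx : x ∈ U) :
    bracket ξ (fun y => ∑ i ∈ s, η i y) x = ∑ i ∈ s, bracket ξ (η i) x := by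
  classical
  induction s using Finset.induction_on with
  | empty => simpa using bracket_zero_right ξ x
  | insert i s hi ih =>
    have hs : ∀ j ∈ s, SmoothVFieldOn U (η j) := fun j hj => hη j (Finset.mem_insert_of_mem hj)
    simp only [Finset.sum_insert hi]
    rw [bracket_add_right hU (hη i (Finset.mem_insert_self i s)) (SmoothVFieldOn.sum hs) hx, ih hs]

end Calculus

/-! ### Algebraic rules for `⟨L, N⟩`. -/

section BracketTensor

variable {n : ℕ} {X : Type*} [TopologicalSpace X] [ChartedSpace (EuclideanSpace ℝ (Fin n)) X]

/-- Comes from antisymmetry of the commutator. When the symmetric part vanishes, it gives `⟨L, N⟩ =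
⟨N, L⟩`. -/
lemma bracketTensor_swap {L N : OpField n X} {x : X} (h : (L x).comp (N x) = (N x).comp (L x))
    (ξ η : VField n X) : bracketTensor L N ξ η x = -bracketTensor N L η ξ x := by
  have h1 : L x (N x (bracket η ξ x)) = N x (L x (bracket η ξ x)) :=
    congrArg (fun A : TangentSpace (𝓡 n) x →L[ℝ] TangentSpace (𝓡 n) x => A (bracket η ξ x)) h
  simp only [bracketTensor]
  rw [bracket_swap ξ η, bracket_swap (applyOp L ξ) (applyOp N η), bracket_swap ξ (applyOp N η),
    bracket_swap (applyOp L ξ) η]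
  simp only [map_neg, h1]
  abel

/-- The terms `L N [ξ, Pξ]` and `N [Lξ, Pξ]` occur on the right with opposite signs and cancel. This
is how values of `⟨L, N⟩` off the diagonal become accessible from products. -/
lemma bracketTensor_comp {L N P : OpField n X} {x : X}
    (h : (L x).comp (N x) = (N x).comp (L x)) (ξ : VField n X) :
    bracketTensor L (fun y => (N y).comp (P y)) ξ ξ x =
      bracketTensor L N ξ (applyOp P ξ) x + N x (bracketTensor L P ξ ξ x) := by
  have h1 (v : TangentSpace (𝓡 n) x) : L x (N x v) = N x (L x v) :=
    congrArg (fun A : TangentSpace (𝓡 n) x →L[ℝ] TangentSpace (𝓡 n) x => A v) h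
  have h2 : applyOp (fun y => (N y).comp (P y)) ξ = applyOp N (applyOp P ξ) := rfl
  simp only [bracketTensor, h2, map_add, map_sub, bracket_self, map_zero, h1,
    ContinuousLinearMap.comp_apply]
  abel

variable [IsManifold (𝓡 n) ∞ X] {U : Set X}

lemma bracketTensor_add_add {L N : OpField n X} (hU : IsOpen U) (hL : SmoothOpFieldOn U L)
    (hN : SmoothOpFieldOn U N) {ξ η : VField n X} (hξ : SmoothVFieldOn U ξ)
    (hη : SmoothVFieldOn U η) {x : X} (hx : x ∈ U) :
    bracketTensor L N (fun y => ξ y + η y) (fun y => ξ y + η y) x =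
      bracketTensor L N ξ ξ x + bracketTensor L N ξ η x + bracketTensor L N η ξ x +
        bracketTensor L N η η x := by
  have e (A : OpField n X) : applyOp A (fun y => ξ y + η y) =
      fun y => applyOp A ξ y + applyOp A η y := by
    funext y; simp [applyOp]
  simp only [bracketTensor, e]
  rw [bracket_add_left hU hξ hη hx, bracket_add_left hU hξ hη hx,
    bracket_add_left hU (hL.applyOp hξ) (hL.applyOp hη) hx,
    bracket_add_left hU (hL.applyOp hξ) (hL.applyOp hη) hx,
    bracket_add_right hU hξ hη hx, bracket_add_right hU hξ hη hx,
    bracket_add_right hU hξ hη hx, bracket_add_right hU hξ hη hx,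
    bracket_add_right hU (hN.applyOp hξ) (hN.applyOp hη) hx,
    bracket_add_right hU (hN.applyOp hξ) (hN.applyOp hη) hx,
    bracket_add_right hU (hN.applyOp hξ) (hN.applyOp hη) hx,
    bracket_add_right hU (hN.applyOp hξ) (hN.applyOp hη) hx]
  simp only [map_add]
  abel

/-- Polarization: the symmetric part of `⟨L, N⟩` is determined by its values on the diagonal. -/
lemma isSymmetryOn_iff {L N : OpField n X} (hL : SmoothOpFieldOn U L) (hN : SmoothOpFieldOn U N)
    (hc : ∀ x ∈ U, (L x).comp (N x) = (N x).comp (L x)) :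
    IsSymmetryOn U L N ↔ ∀ V : Set X, IsOpen V → V ⊆ U → ∀ ξ : VField n X, SmoothVFieldOn V ξ →
      ∀ x ∈ V, bracketTensor L N ξ ξ x = 0 := by
  constructor
  · intro h V hV hVU ξ hξ x hx
    have h2 := h.symm_part V hV hVU ξ ξ hξ hξ x hx
    rw [← two_smul ℝ] at h2
    exact (smul_eq_zero.1 h2).resolve_left two_ne_zero
  · refine fun h => ⟨hL, hN, hc, fun V hV hVU ξ η hξ hη x hx => ?_⟩
    have h2 := h V hV hVU _ (hξ.add hη) x hx
    rw [bracketTensor_add_add hV (hL.mono hVU) (hN.mono hVU) hξ hη hx, h V hV hVU ξ hξ x hx,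
      h V hV hVU η hη x hx] at h2
    simpa using h2

lemma IsSymmetryOn.bracketTensor_self {L N : OpField n X} (h : IsSymmetryOn U L N) {V : Set X}
    (hV : IsOpen V) (hVU : V ⊆ U) {ξ : VField n X} (hξ : SmoothVFieldOn V ξ) {x : X}
    (hx : x ∈ V) : bracketTensor L N ξ ξ x = 0 :=
  (isSymmetryOn_iff h.smooth_left h.smooth_right h.commute).1 h V hV hVU ξ hξ x hx

/-- Leibniz rule in the second slot: the coefficients are differentiated only in `[Lξ, Nξ]` and in
`L [ξ, Nξ]`, since `[ξ, ξ] = 0` removes the first term and `N [Lξ, ξ]` is linear in `N`. -/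
lemma bracketTensor_combination {L : OpField n X} {h : Fin n → X → ℝ} {K : Fin n → OpField n X}
    (hU : IsOpen U) (hh : ∀ i, SmoothFunOn n U (h i)) (hK : ∀ i, SmoothOpFieldOn U (K i))
    {ξ : VField n X} (hξ : SmoothVFieldOn U ξ) {x : X} (hx : x ∈ U) :
    bracketTensor L (combination h K) ξ ξ x =
      ∑ j, h j x • bracketTensor L (K j) ξ ξ x +
        ∑ j, (differential n (h j) x (L x (ξ x)) • K j x (ξ x) -
          differential n (h j) x (ξ x) • L x (K j x (ξ x))) := by
  have e : applyOp (combination h K) ξ = fun y => ∑ j, h j y • applyOp (K j) ξ y := by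
    funext y
    simp [applyOp, combination]
  have hs (j : Fin n) : SmoothVFieldOn U (applyOp (K j) ξ) := (hK j).applyOp hξ
  have b (η : VField n X) : bracket η (applyOp (combination h K) ξ) x =
      ∑ j, (differential n (h j) x (η x) • K j x (ξ x) + h j x • bracket η (applyOp (K j) ξ) x) := by
    rw [e, bracket_sum_right _ hU (fun j _ => (hs j).smul (hh j)) hx]
    exact Finset.sum_congr rfl fun j _ => bracket_smul_right hU (hh j) (hs j) hx
  simp only [bracketTensor, b, bracket_self, map_zero, zero_add]
  have e2 : combination h K x (bracket (applyOp L ξ) ξ x) =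
      ∑ j, h j x • K j x (bracket (applyOp L ξ) ξ x) := by
    simp [combination]
  rw [e2, map_sum, ← Finset.sum_sub_distrib, ← Finset.sum_sub_distrib, ← Finset.sum_add_distrib]
  refine Finset.sum_congr rfl fun j _ => ?_
  simp only [map_add, map_smul, smul_sub, applyOp]
  abel

/-- The defect of `∑ h j • K j` from being a symmetry of `L` is algebraic in the differentials
of the coefficients, when the `K j` are symmetries of `L`. -/
lemma bracketTensor_combination_of_isSymmetryOn {L : OpField n X} {h : Fin n → X → ℝ}
    {K : Fin n → OpField n X} (hsym : ∀ j, IsSymmetryOn U L (K j)) {V : Set X}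
    (hV : IsOpen V) (hVU : V ⊆ U) (hh : ∀ i, SmoothFunOn n V (h i))
    {ξ : VField n X} (hξ : SmoothVFieldOn V ξ) {x : X} (hx : x ∈ V) :
    bracketTensor L (combination h K) ξ ξ x =
        ∑ j, (differential n (h j) x (L x (ξ x)) • K j x (ξ x) -
          differential n (h j) x (ξ x) • L x (K j x (ξ x))) := by
  rw [bracketTensor_combination hV hh (fun j => (hsym j).smooth_right.mono hVU) hξ hx,
    Finset.sum_eq_zero, zero_add]
  intro j _
  rw [(hsym j).bracketTensor_self hV hVU hξ hx, smul_zero]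

end BracketTensor

/-! ### Commuting operators with a cyclic vector on one tangent space. -/

section PointwiseAlgebra

variable {n : ℕ} {T : Type*} [AddCommGroup T] [Module ℝ T] [TopologicalSpace T]
  [IsTopologicalAddGroup T] [ContinuousSMul ℝ T] {A : Fin n → T →L[ℝ] T}

lemma eq_of_sum_smul_eq {ξ : T} (hξ : LinearIndependent ℝ fun i => A i ξ) {f g : Fin n → ℝ}
    (h : ∑ i, f i • A i = ∑ i, g i • A i) : f = g := by
  have h0 := congrArg (fun B : T →L[ℝ] T => B ξ) h
  simp only [sum_apply, smul_apply] at h0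
  have h1 := Fintype.linearIndependent_iff.1 hξ (fun i => f i - g i)
    (by simp only [sub_smul, Finset.sum_sub_distrib, h0, sub_self])
  exact funext fun i => sub_eq_zero.1 (h1 i)

/-- The centralizer of a commuting family with a cyclic vector is its span. -/
lemma exists_eq_sum_smul_of_commute [FiniteDimensional ℝ T] (hT : Module.finrank ℝ T = n)
    (hcomm : ∀ i j, (A i).comp (A j) = (A j).comp (A i)) {ξ : T}
    (hξ : LinearIndependent ℝ fun i => A i ξ) {B : T →L[ℝ] T}
    (hB : ∀ i, B.comp (A i) = (A i).comp B) : ∃ d : Fin n → ℝ, B = ∑ k, d k • A k := by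
  have hspan := hξ.span_eq_top_of_card_eq_finrank' (by simp [hT])
  have mem (v : T) : ∃ d : Fin n → ℝ, ∑ k, d k • A k ξ = v := by
    rw [← Submodule.mem_span_range_iff_exists_fun, hspan]
    trivial
  -- `B` is determined by `B ξ`, as `B (A i ξ) = A i (B ξ)`; the coefficients of `B ξ` in the basis
  -- `A k ξ` are therefore those of `B`.
  obtain ⟨d, hd⟩ := mem (B ξ)
  have e (i : Fin n) (v : T) : B (A i v) = A i (B v) :=
    congrArg (fun C : T →L[ℝ] T => C v) (hB i)
  have e' (i j : Fin n) (v : T) : A i (A j v) = A j (A i v) :=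
    congrArg (fun C : T →L[ℝ] T => C v) (hcomm i j)
  refine ⟨d, ContinuousLinearMap.ext fun v => ?_⟩
  obtain ⟨w, rfl⟩ := mem v
  simp only [map_sum, map_smul, e, ← hd, sum_apply,
    smul_apply, Finset.smul_sum]
  refine Finset.sum_congr rfl fun k _ => Finset.sum_congr rfl fun i _ => ?_
  rw [e', smul_comm]

omit [IsTopologicalAddGroup T] [ContinuousSMul ℝ T] in
/-- If linear forms `φ k` satisfy `∑ k, φ k v • A k v = 0` for all `v` and the `A k` have a
common cyclic vector, then they vanish. -/
lemma forms_eq_zero_of_sum_smul_apply_eq_zero {ξ : T} (hξ : LinearIndependent ℝ fun i => A i ξ)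
    {φ : Fin n → T →L[ℝ] ℝ} (h : ∀ v, ∑ k, φ k v • A k v = 0) (k : Fin n) : φ k = 0 := by
  rw [Fintype.linearIndependent_iff] at hξ
  have h0 := hξ (fun k => φ k ξ) (h ξ)
  refine ContinuousLinearMap.ext fun w => hξ (fun k => φ k w) ?_ k
  -- The forms already vanish at `ξ`, so polarizing at `ξ + w` leaves `∑ φ k w • A k ξ = 0`.
  have h1 := h (ξ + w)
  simp only [map_add, smul_add, add_smul, Finset.sum_add_distrib, h w, h0, zero_smul,
    Finset.sum_const_zero] at h1
  simpa using h1

/-! ### Structure constants, the invariant form and its dual basis. -/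

section StructureConstants

variable {c : Fin n → Fin n → Fin n → ℝ} (hc : ∀ i j, (A i).comp (A j) = ∑ k, c i j k • A k)
  (hcomm : ∀ i j, (A i).comp (A j) = (A j).comp (A i)) {ξ : T}
  (hξ : LinearIndependent ℝ fun i => A i ξ)
include hc hcomm hξ

lemma structureConstants_comm (i j : Fin n) : c i j = c j i :=
  eq_of_sum_smul_eq hξ (by rw [← hc, ← hc, hcomm])

omit hcomm hξ in
lemma comp_comp_eq_sum (p r l : Fin n) :
    (A p).comp ((A r).comp (A l)) = ∑ k, (∑ s, c r l s * c p s k) • A k := by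
  rw [hc]
  ext v
  have h (s : Fin n) : A p (A s v) = ∑ k, c p s k • A k v := by
    have := congrArg (fun C : T →L[ℝ] T => C v) (hc p s)
    simpa using this
  simp only [ContinuousLinearMap.comp_apply, sum_apply,
    smul_apply, map_sum, map_smul, h, Finset.smul_sum, Finset.sum_smul,
    smul_smul]
  rw [Finset.sum_comm]

lemma structureConstants_assoc (p r l k : Fin n) :
    ∑ s, c r l s * c p s k = ∑ s, c p l s * c r s k := by
  have h : (A p).comp ((A r).comp (A l)) = (A r).comp ((A p).comp (A l)) := by
    rw [← ContinuousLinearMap.comp_assoc, hcomm p r, ContinuousLinearMap.comp_assoc]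
  rw [comp_comp_eq_sum hc, comp_comp_eq_sum hc] at h
  exact congrFun (eq_of_sum_smul_eq hξ h) k

omit hcomm in
lemma structureConstants_one {ε : Fin n → ℝ}
    (hε : ContinuousLinearMap.id ℝ T = ∑ i, ε i • A i) (m k : Fin n) :
    ∑ i, ε i * c i m k = if m = k then 1 else 0 := by
  have h : ∑ k, (∑ i, ε i * c i m k) • A k = ∑ k, (if m = k then (1 : ℝ) else 0) • A k := by
    have h1 : (ContinuousLinearMap.id ℝ T).comp (A m) = A m := by ext; simp
    rw [hε] at h1
    simp only [ite_smul, one_smul, zero_smul, Finset.sum_ite_eq, Finset.mem_univ, if_true]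
    rw [← h1]
    ext v
    have h (i : Fin n) : A i (A m v) = ∑ k, c i m k • A k v := by
      have := congrArg (fun C : T →L[ℝ] T => C v) (hc i m)
      simpa using this
    simp only [ContinuousLinearMap.comp_apply, sum_apply,
      smul_apply, h, Finset.smul_sum, Finset.sum_smul, smul_smul]
    rw [Finset.sum_comm]
  exact congrFun (eq_of_sum_smul_eq hξ h) k

variable {a : Fin n → ℝ} {B : Matrix (Fin n) (Fin n) ℝ} (hB : ∀ i j, B i j = ∑ k, c i j k * a k)
include hB

/-- The form is a linear functional applied to the product, so this is `(A_p A_j) A_m = A_j (A_p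
A_m)` read through that functional. -/
lemma form_invariant (p j m : Fin n) : ∑ k, c p j k * B k m = ∑ k, B j k * c p m k := by
  simp only [hB, Finset.mul_sum, Finset.sum_mul]
  rw [Finset.sum_comm, Finset.sum_comm (s := Finset.univ) (t := Finset.univ)
    (f := fun k t => c j k t * a t * c p m k)]
  refine Finset.sum_congr rfl fun t _ => ?_
  have := structureConstants_assoc hc hcomm hξ j p m t
  have h2 : ∑ k, c p j k * c k m t = ∑ s, c p m s * c j s t := by
    rw [this, structureConstants_comm hc hcomm hξ p j]
    have h3 := structureConstants_assoc hc hcomm hξ m j p t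
    rw [structureConstants_comm hc hcomm hξ m p, this] at h3
    rw [← h3]
    exact Finset.sum_congr rfl fun k _ => by rw [structureConstants_comm hc hcomm hξ k m]
  calc ∑ k, c p j k * (c k m t * a t) = (∑ k, c p j k * c k m t) * a t := by
        rw [Finset.sum_mul]; exact Finset.sum_congr rfl fun k _ => by ring
    _ = ∑ k, c j k t * a t * c p m k := by
        rw [h2, Finset.sum_mul]; exact Finset.sum_congr rfl fun k _ => by ring

variable (hdet : B.det ≠ 0)
include hdet

omit hc hcomm hξ hB in
lemma mul_sum_inv (i m : Fin n) : ∑ j, B⁻¹ i j * B j m = if i = m then 1 else 0 := by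
  rw [← Matrix.mul_apply, Matrix.nonsing_inv_mul _ (isUnit_iff_ne_zero.2 hdet), Matrix.one_apply]

omit hc hcomm hξ hB in
lemma sum_mul_inv (i m : Fin n) : ∑ j, B i j * B⁻¹ j m = if i = m then 1 else 0 := by
  rw [← Matrix.mul_apply, Matrix.mul_nonsing_inv _ (isUnit_iff_ne_zero.2 hdet), Matrix.one_apply]

/-- With `P` the matrix `c p`, invariance reads `P B = B Pᵀ`; multiply by `B⁻¹` on both sides. -/
lemma inv_form_invariant (p s k : Fin n) :
    ∑ j, B⁻¹ s j * c p j k = ∑ l, c p l s * B⁻¹ l k := by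
  set P : Matrix (Fin n) (Fin n) ℝ := Matrix.of (c p) with hP
  have hu := isUnit_iff_ne_zero.2 hdet
  have h : P * B = B * P.transpose := by
    ext j m
    simp only [Matrix.mul_apply, hP, Matrix.transpose_apply, Matrix.of_apply]
    exact form_invariant hc hcomm hξ hB p j m
  have h2 : B⁻¹ * P = P.transpose * B⁻¹ := by
    calc B⁻¹ * P = B⁻¹ * (P * B) * B⁻¹ := by
          rw [Matrix.mul_assoc, Matrix.mul_assoc, Matrix.mul_nonsing_inv _ hu, Matrix.mul_one]
      _ = P.transpose * B⁻¹ := by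
          rw [h, ← Matrix.mul_assoc, Matrix.nonsing_inv_mul _ hu, Matrix.one_mul]
  have h3 := congrFun (congrFun h2 s) k
  simpa only [Matrix.mul_apply, hP, Matrix.transpose_apply, Matrix.of_apply] using h3

omit hc hcomm hξ hB in
-- Stated in a general module `W` so that it serves both the generic vector and the generic covector
-- of the dual basis.
lemma linearIndependent_dual {W : Type*} [AddCommGroup W] [Module ℝ W] {u w : Fin n → W}
    (hu : LinearIndependent ℝ u) (hw : ∀ i, w i = ∑ j, B⁻¹ i j • u j) :
    LinearIndependent ℝ w := by
  rw [Fintype.linearIndependent_iff] at hu ⊢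
  intro g hg i
  have h1 : ∑ j, (∑ i, g i * B⁻¹ i j) • u j = 0 := by
    rw [← hg]
    simp only [hw, Finset.smul_sum, smul_smul, Finset.sum_smul]
    rw [Finset.sum_comm]
  have h2 := hu _ h1
  have h3 : ∑ j, (∑ i, g i * B⁻¹ i j) * B j i = 0 := by simp [h2]
  have h4 : ∑ j, (∑ i, g i * B⁻¹ i j) * B j i = g i := by
    simp only [Finset.sum_mul, mul_assoc]
    rw [Finset.sum_comm]
    simp only [← Finset.mul_sum, mul_sum_inv hdet]
    simp
  rw [← h4, h3]

variable {D : Fin n → T →L[ℝ] T} (hD : ∀ i, D i = ∑ j, B⁻¹ i j • A j)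
include hD

omit hc hcomm hξ hB in
lemma sum_smul_dual (i : Fin n) : ∑ j, B i j • D j = A i := by
  simp only [hD, Finset.smul_sum, smul_smul]
  rw [Finset.sum_comm]
  simp only [← Finset.sum_smul, sum_mul_inv hdet]
  simp

lemma comp_dual (p s : Fin n) : (A p).comp (D s) = ∑ l, c p l s • D l := by
  have h1 : (A p).comp (D s) = ∑ k, (∑ j, B⁻¹ s j * c p j k) • A k := by
    ext v
    have h (j : Fin n) : A p (A j v) = ∑ k, c p j k • A k v := by
      have := congrArg (fun C : T →L[ℝ] T => C v) (hc p j)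
      simpa using this
    simp only [hD, ContinuousLinearMap.comp_apply, sum_apply,
      smul_apply, map_sum, map_smul, h, Finset.smul_sum, Finset.sum_smul,
      smul_smul]
    rw [Finset.sum_comm]
  rw [h1]
  simp only [inv_form_invariant hc hcomm hξ hB hdet, hD, Finset.smul_sum, Finset.sum_smul,
    smul_smul]
  rw [Finset.sum_comm]

omit hc hξ hB hdet in
lemma dual_commute (p s : Fin n) : (A p).comp (D s) = (D s).comp (A p) := by
  ext v
  have h (j : Fin n) : A p (A j v) = A j (A p v) :=
    congrArg (fun C : T →L[ℝ] T => C v) (hcomm p j)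
  simp [hD, h]

omit hc hξ hB hdet in
lemma dual_commute_dual (r s : Fin n) : (D r).comp (D s) = (D s).comp (D r) := by
  ext v
  have h (j : Fin n) (w : T) : A j (D s w) = D s (A j w) :=
    congrArg (fun C : T →L[ℝ] T => C w) (dual_commute hcomm hD j s)
  have h2 (w : T) : D r w = ∑ j, B⁻¹ r j • A j w := by simp [hD]
  simp [h2, h]

/-- The identity lies in the centralizer, so `Id = ∑ ε_i A_i`. Pairing `Id · A_m = A_m` with the
functional gives `∑ ε_i B i m = a m`, and `A_i = ∑ B i s D_s` finishes. -/
lemma id_eq_sum_smul_dual [FiniteDimensional ℝ T] (hT : Module.finrank ℝ T = n) :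
    ContinuousLinearMap.id ℝ T = ∑ s, a s • D s := by
  obtain ⟨ε, hε⟩ := exists_eq_sum_smul_of_commute hT hcomm hξ
    (B := ContinuousLinearMap.id ℝ T) fun i => by ext; simp
  have h1 := structureConstants_one hc hξ hε
  have h2 (m : Fin n) : ∑ i, ε i * B i m = a m := by
    simp only [hB, Finset.mul_sum]
    rw [Finset.sum_comm]
    calc ∑ k, ∑ i, ε i * (c i m k * a k) = ∑ k, (∑ i, ε i * c i m k) * a k := by
          simp only [Finset.sum_mul, mul_assoc]
      _ = a m := by simp [h1]
  calc ContinuousLinearMap.id ℝ T = ∑ i, ε i • ∑ s, B i s • D s := by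
        rw [hε]; exact Finset.sum_congr rfl fun i _ => by rw [sum_smul_dual hdet hD]
    _ = ∑ s, a s • D s := by
        simp only [Finset.smul_sum, smul_smul]
        rw [Finset.sum_comm]
        simp only [← Finset.sum_smul, h2]

/-- The algebraic form of the correspondence between symmetries and conservation laws. -/
lemma comp_eq_sum_iff_dual {φ : Fin n → T →L[ℝ] ℝ} :
    (∀ i k, (φ k).comp (A i) = ∑ j, c i j k • φ j) ↔
      ∀ i, (∑ s, a s • φ s).comp (D i) = φ i := by
  constructor
  · intro h i
    have h1 (j : Fin n) (v : T) : ∑ s, a s * φ s (A j v) = ∑ m, B j m * φ m v := by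
      have h2 (s : Fin n) : φ s (A j v) = ∑ m, c j m s * φ m v := by
        have := congrArg (fun C : T →L[ℝ] ℝ => C v) (h j s)
        simpa using this
      simp only [h2, hB, Finset.mul_sum, Finset.sum_mul]
      rw [Finset.sum_comm]
      exact Finset.sum_congr rfl fun _ _ => Finset.sum_congr rfl fun _ _ => by ring
    ext v
    simp only [hD, ContinuousLinearMap.comp_apply, sum_apply,
      smul_apply, map_sum, map_smul, smul_eq_mul]
    calc ∑ j, B⁻¹ i j * ∑ s, a s * φ s (A j v) = ∑ m, (∑ j, B⁻¹ i j * B j m) * φ m v := by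
          simp only [h1, Finset.mul_sum, Finset.sum_mul, mul_assoc]
          rw [Finset.sum_comm]
      _ = φ i v := by simp [mul_sum_inv hdet]
  -- The converse uses only `φ k = ψ ∘ D k`, whatever `ψ` is: then `φ k ∘ A i = ψ ∘ (A i ∘ D k)`, to
  -- which `comp_dual` applies.
  · generalize (∑ s, a s • φ s) = ψ
    intro h i k
    rw [← h k, ContinuousLinearMap.comp_assoc, ← dual_commute hcomm hD,
      comp_dual hc hcomm hξ hB hdet hD]
    simp only [← h]
    ext v
    simp only [ContinuousLinearMap.comp_apply, sum_apply, smul_apply, map_sum, map_smul]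

/-- The structure constants of the dual basis, paired with the coefficients of the identity. -/
lemma sum_dual_structureConstants {β : Fin n → ℝ}
    (hβ : ContinuousLinearMap.id ℝ T = ∑ i, β i • A i) {d : Fin n → Fin n → Fin n → ℝ}
    (hd : ∀ i j, (D i).comp (D j) = ∑ k, d i j k • D k) (i j : Fin n) :
    ∑ k, d i j k * β k = B⁻¹ i j := by
  have hind : LinearIndependent ℝ fun i => D i ξ := linearIndependent_dual hdet hξ
    fun i => by simp [hD]
  have h1 : (D i).comp (D j) = ∑ l, (∑ p, B⁻¹ i p * c p l j) • D l := by
    have h2 : (D i).comp (D j) = ∑ p, B⁻¹ i p • (A p).comp (D j) := by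
      ext v; simp [hD i]
    rw [h2]
    simp only [comp_dual hc hcomm hξ hB hdet hD, Finset.smul_sum, smul_smul, Finset.sum_smul]
    rw [Finset.sum_comm]
  rw [hd] at h1
  have h3 := eq_of_sum_smul_eq hind h1
  simp only [h3]
  have h4 := structureConstants_one hc hξ hβ
  calc ∑ k, (∑ p, B⁻¹ i p * c p k j) * β k = ∑ p, B⁻¹ i p * ∑ k, β k * c k p j := by
        simp only [Finset.mul_sum, Finset.sum_mul]
        rw [Finset.sum_comm]
        refine Finset.sum_congr rfl fun p _ => Finset.sum_congr rfl fun k _ => ?_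
        rw [structureConstants_comm hc hcomm hξ p k]; ring
    _ = B⁻¹ i j := by simp [h4]

end StructureConstants

end PointwiseAlgebra

/-! ### Smoothness of coefficients in a moving frame. -/

section Smoothness

variable {n : ℕ} {X : Type*} [TopologicalSpace X] [ChartedSpace (EuclideanSpace ℝ (Fin n)) X]

/-- The coefficients of a smooth map with respect to a smooth moving basis are smooth. -/
lemma contMDiffAt_coeff {F : Type*} [NormedAddCommGroup F] [NormedSpace ℝ F]
    [FiniteDimensional ℝ F] (hF : Module.finrank ℝ F = n) {g : Fin n → X → F} {w : X → F}
    {c : X → Fin n → ℝ} {x : X} (hg : ∀ i, ContMDiffAt (𝓡 n) 𝓘(ℝ, F) ∞ (g i) x)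
    (hw : ContMDiffAt (𝓡 n) 𝓘(ℝ, F) ∞ w x) (h : ∀ᶠ y in 𝓝 x, w y = ∑ i, c y i • g i y)
    (hind : LinearIndependent ℝ fun i => g i x) (k : Fin n) :
    ContMDiffAt (𝓡 n) 𝓘(ℝ, ℝ) ∞ (fun y => c y k) x := by
  -- `P y` sends coefficients to the combination of the frame. It is invertible at `x`, hence
  -- nearby, and inversion of operators is smooth, so `c = P⁻¹ w` is smooth.
  set P : X → (Fin n → ℝ) →L[ℝ] F := fun y =>
    ∑ i, (ContinuousLinearMap.proj (R := ℝ) (φ := fun _ : Fin n => ℝ) i).smulRight (g i y) with hP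
  have hPa (y : X) (v : Fin n → ℝ) : P y v = ∑ i, v i • g i y := by simp [hP]
  have hPs : ContMDiffAt (𝓡 n) 𝓘(ℝ, (Fin n → ℝ) →L[ℝ] F) ∞ P x := by
    refine ContMDiffAt.sum fun i _ => ?_
    exact (ContinuousLinearMap.smulRightL ℝ (Fin n → ℝ) F
      (ContinuousLinearMap.proj (R := ℝ) (φ := fun _ : Fin n => ℝ) i)).contDiff.contMDiff.contMDiffAt.comp
        x (hg i)
  have hinj : Function.Injective (P x : (Fin n → ℝ) →ₗ[ℝ] F) := by
    refine (injective_iff_map_eq_zero _).2 fun v hv => ?_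
    have h1 : ∑ i, v i • g i x = 0 := by rw [← hPa]; exact hv
    exact funext (Fintype.linearIndependent_iff.1 hind v h1)
  let e : (Fin n → ℝ) ≃L[ℝ] F :=
    (LinearEquiv.ofInjectiveOfFinrankEq (P x : (Fin n → ℝ) →ₗ[ℝ] F) hinj
      (by simp [hF])).toContinuousLinearEquiv
  have he : (e : (Fin n → ℝ) →L[ℝ] F) = P x := by
    ext v; rfl
  have hinv : ContMDiffAt (𝓡 n) 𝓘(ℝ, F →L[ℝ] (Fin n → ℝ)) ∞ (fun y => (P y).inverse) x := by
    have h1 := contDiffAt_map_inverse (𝕜 := ℝ) (n := ∞) e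
    rw [he] at h1
    exact h1.contMDiffAt.comp x hPs
  have hev : ∀ᶠ y in 𝓝 x, P y ∈ range ((↑) : ((Fin n → ℝ) ≃L[ℝ] F) → _) := by
    refine hPs.continuousAt.eventually ?_
    rw [← he]
    exact ContinuousLinearEquiv.nhds e
  have hc : ContMDiffAt (𝓡 n) 𝓘(ℝ, Fin n → ℝ) ∞ (fun y => (P y).inverse (w y)) x :=
    hinv.clm_apply hw
  have hck : ContMDiffAt (𝓡 n) 𝓘(ℝ, ℝ) ∞ (fun y => (P y).inverse (w y) k) x :=
    (contMDiffAt_pi_space.1 hc) k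
  refine hck.congr_of_eventuallyEq ?_
  filter_upwards [h, hev] with y hy ⟨e', he'⟩
  rw [hy, ← hPa, ← he', ContinuousLinearMap.inverse_equiv]
  simp

variable [IsManifold (𝓡 n) ∞ X]

lemma contMDiffAt_coeff_vField {U : Set X} (hU : IsOpen U) {ξ : Fin n → VField n X}
    {η : VField n X} (hξ : ∀ i, SmoothVFieldOn U (ξ i)) (hη : SmoothVFieldOn U η)
    {c : X → Fin n → ℝ} (h : ∀ y ∈ U, η y = ∑ i, c y i • ξ i y) {x : X} (hx : x ∈ U)
    (hind : LinearIndependent ℝ fun i => ξ i x) (k : Fin n) :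
    ContMDiffAt (𝓡 n) 𝓘(ℝ, ℝ) ∞ (fun y => c y k) x := by
  set t := trivializationAt (EuclideanSpace ℝ (Fin n)) (fun x : X => TangentSpace (𝓡 n) x) x with ht
  have hxt : x ∈ t.baseSet := FiberBundle.mem_baseSet_trivializationAt' x
  have hs {ζ : VField n X} (hζ : SmoothVFieldOn U ζ) :
      ContMDiffAt (𝓡 n) 𝓘(ℝ, EuclideanSpace ℝ (Fin n)) ∞ (fun y => (t ⟨y, ζ y⟩).2) x :=
    (contMDiffAt_section (E := fun x : X => TangentSpace (𝓡 n) x) x).1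
      (ContMDiffOn.contMDiffAt hζ (hU.mem_nhds hx))
  have hlin {y : X} (hy : y ∈ t.baseSet) (v : TangentSpace (𝓡 n) y) :
      (t ⟨y, v⟩).2 = t.linearEquivAt ℝ y hy v := rfl
  refine contMDiffAt_coeff (by simp) (fun i => hs (hξ i)) (hs hη) ?_ ?_ k
  · filter_upwards [hU.mem_nhds hx, t.open_baseSet.mem_nhds hxt] with y hy hyt
    simp only [hlin hyt, h y hy, map_sum, map_smul]
  · simp only [hlin hxt]
    exact hind.map' _ (t.linearEquivAt ℝ x hxt).ker

end Smoothness

/-! ### Existence and smoothness of the structure functions and of the dual basis. -/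

section FrobeniusAlgebra

variable {n : ℕ} {X : Type*} [TopologicalSpace X] [ChartedSpace (EuclideanSpace ℝ (Fin n)) X]

instance finiteDimensional_tangentSpace (x : X) : FiniteDimensional ℝ (TangentSpace (𝓡 n) x) :=
  inferInstanceAs (FiniteDimensional ℝ (EuclideanSpace ℝ (Fin n)))

lemma finrank_tangentSpace (x : X) : Module.finrank ℝ (TangentSpace (𝓡 n) x) = n :=
  finrank_euclideanSpace_fin (𝕜 := ℝ)

lemma frobeniusForm_apply (K : Fin n → OpField n X) (a : Fin n → ℝ) (x : X) (i j : Fin n) :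
    frobeniusForm K a x i j = ∑ k, structureFun K i j x k * a k := rfl

lemma dualBasis_eq_combination (K : Fin n → OpField n X) (a : Fin n → ℝ) (i : Fin n) :
    dualBasis K a i = combination (fun j x => (frobeniusForm K a x)⁻¹ i j) K := rfl

variable [IsManifold (𝓡 n) ∞ X] {K : Fin n → OpField n X} (hK : IsOperatorFrobeniusAlgebra K)
include hK

lemma comp_eq_sum_structureFun (x : X) (i j : Fin n) :
    (K i x).comp (K j x) = ∑ k, structureFun K i j x k • K k x := by
  obtain ⟨ξ, hξ⟩ := hK.exists_generic_vector x
  have h : ∃ d : Fin n → ℝ, (K i x).comp (K j x) = ∑ k, d k • K k x := by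
    refine exists_eq_sum_smul_of_commute (finrank_tangentSpace x)
      (fun i j => hK.commute i j x) hξ fun l => ?_
    rw [ContinuousLinearMap.comp_assoc, hK.commute j l, ← ContinuousLinearMap.comp_assoc,
      hK.commute i l, ContinuousLinearMap.comp_assoc]
  exact Classical.epsilon_spec h

lemma smoothFunOn_structureFun (i j k : Fin n) :
    SmoothFunOn n univ (fun x => structureFun K i j x k) := by
  intro x _
  obtain ⟨v, hv⟩ := hK.exists_generic_vector x
  obtain ⟨V, hV, hxV, -, ξ, hξ, rfl⟩ := exists_smoothVField_eq isOpen_univ (mem_univ x) v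
  -- The structure functions are the coefficients of `K_i K_j ξ` in the frame `K_l ξ`, with `ξ` a
  -- smooth extension of the generic vector.
  have hs (i : Fin n) : SmoothOpFieldOn V (K i) := (hK.smooth i).mono (subset_univ V)
  refine (contMDiffAt_coeff_vField hV (fun l => (hs l).applyOp hξ)
    ((hs i).applyOp ((hs j).applyOp hξ)) (c := fun y => structureFun K i j y) (fun y _ => ?_)
    hxV hv k).contMDiffWithinAt
  have := congrArg (fun B : TangentSpace (𝓡 n) y →L[ℝ] TangentSpace (𝓡 n) y => B (ξ y))
    (comp_eq_sum_structureFun hK y i j)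
  simpa [applyOp] using this

lemma smoothFunOn_frobeniusForm (a : Fin n → ℝ) (i j : Fin n) :
    SmoothFunOn n univ (fun x => frobeniusForm K a x i j) := by
  simp only [frobeniusForm_apply]
  exact contMDiffOn_finsetSum fun k _ =>
    ContMDiffOn.mul (smoothFunOn_structureFun hK i j k) contMDiffOn_const

lemma smoothFunOn_frobeniusForm_inv {a : Fin n → ℝ} (ha : ∀ x, (frobeniusForm K a x).det ≠ 0)
    (i j : Fin n) : SmoothFunOn n univ (fun x => (frobeniusForm K a x)⁻¹ i j) := by
  intro x _
  -- Row `i` of the inverse consists of the coefficients of the `i`-th unit vector in the rows of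
  -- `b`.
  refine (contMDiffAt_coeff (F := Fin n → ℝ) (by simp) (g := fun i x => frobeniusForm K a x i)
    (w := fun _ => Pi.single i 1) (c := fun y => (frobeniusForm K a y)⁻¹ i) (fun l => ?_)
    contMDiffAt_const (Filter.Eventually.of_forall fun y => ?_) ?_ j).contMDiffWithinAt
  · exact contMDiffAt_pi_space.2 fun m =>
      ContMDiffOn.contMDiffAt (smoothFunOn_frobeniusForm hK a l m) Filter.univ_mem
  · funext m
    have := mul_sum_inv (ha y) i m
    simp only [Finset.sum_apply, Pi.smul_apply, smul_eq_mul, this, Pi.single_apply, eq_comm]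
  · exact Matrix.linearIndependent_rows_of_det_ne_zero (ha x)

lemma smoothOpFieldOn_dualBasis {a : Fin n → ℝ} (ha : ∀ x, (frobeniusForm K a x).det ≠ 0)
    (i : Fin n) : SmoothOpFieldOn univ (dualBasis K a i) :=
  smoothOpFieldOn_combination (fun j => smoothFunOn_frobeniusForm_inv hK ha i j) hK.smooth

end FrobeniusAlgebra

/-! ### The pointwise identity behind statement (1). -/

section DualVariation

variable {n : ℕ} {T : Type*} [AddCommGroup T] [Module ℝ T] [TopologicalSpace T]
  [IsTopologicalAddGroup T] [ContinuousSMul ℝ T] {A D : Fin n → T →L[ℝ] T}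
  {c : Fin n → Fin n → Fin n → ℝ} {B C : Matrix (Fin n) (Fin n) ℝ}
  {δB δC : Fin n → Fin n → T →L[ℝ] ℝ}

/-- The algebraic identity behind the symmetry of the dual basis: `δB` and `δC` stand for the
differentials of the entries of the form and of its inverse. -/
lemma dual_variation_eq_zero (hAD : ∀ i, A i = ∑ j, B i j • D j)
    (hDA : ∀ i, D i = ∑ j, C i j • A j)
    (hcD : ∀ p s, (A p).comp (D s) = ∑ l, c p l s • D l)
    (hδ : ∀ i m v, ∑ j, (δC i j v * B j m + C i j * δB j m v) = 0)
    (hw : ∀ p r l v, δB r l (A p v) - ∑ s, δB r s v * c p l s =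
      δB p l (A r v) - ∑ s, δB p s v * c r l s) (i j : Fin n) (v : T) :
    ∑ q, C j q • -(∑ p, (δC i p (A q v) • A p v - δC i p v • A q (A p v))) +
      ∑ q, (δC j q (D i v) • A q v - δC j q v • D i (A q v)) = 0 := by
  have hA (i : Fin n) (v : T) : A i v = ∑ j, B i j • D j v := by
    rw [hAD i]; simp only [sum_apply, smul_apply]
  have hD (i : Fin n) (v : T) : D i v = ∑ j, C i j • A j v := by
    rw [hDA i]; simp only [sum_apply, smul_apply]
  have hAD' (p s : Fin n) (v : T) : A p (D s v) = ∑ l, c p l s • D l v := by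
    have := congrArg (fun C : T →L[ℝ] T => C v) (hcD p s)
    simpa only [sum_apply, smul_apply, ContinuousLinearMap.comp_apply] using this
  -- The derivative terms of `⟨K_p, ∑ b_{rs} M^s⟩`. In the basis `D l v` its coefficients are the
  -- two sides of `hw`, hence the symmetry.
  set W : Fin n → Fin n → T := fun p r => ∑ s, (δB r s (A p v) • D s v - δB r s v • A p (D s v))
    with hWdef
  have hW (p r : Fin n) : W p r = W r p := by
    have e (p r : Fin n) : W p r = ∑ l, (δB r l (A p v) - ∑ s, δB r s v * c p l s) • D l v := by
      simp only [hWdef, hAD', sub_smul, Finset.sum_sub_distrib, Finset.sum_smul, Finset.smul_sum,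
        smul_smul]
      congr 1
      rw [Finset.sum_comm]
    rw [e, e]
    exact Finset.sum_congr rfl fun l _ => by rw [hw]
  -- `hδ` is `δC · B = -C · δB`; this trades derivatives of the inverse for derivatives of the form.
  have hδA (i : Fin n) (u w : T) :
      ∑ q, δC i q u • A q w = -∑ r, C i r • ∑ s, δB r s u • D s w := by
    rw [eq_neg_iff_add_eq_zero]
    simp only [hA, Finset.smul_sum, smul_smul]
    rw [Finset.sum_comm, Finset.sum_comm (f := fun r s => (C i r * δB r s u) • D s w),
      ← Finset.sum_add_distrib]
    refine Finset.sum_eq_zero fun m _ => ?_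
    rw [← Finset.sum_add_distrib, ← zero_smul ℝ (D m w), ← hδ i m u, Finset.sum_smul]
    exact Finset.sum_congr rfl fun q _ => (add_smul _ _ _).symm
  have hy (i j : Fin n) : ∑ q, (δC j q (D i v) • A q v - δC j q v • D i (A q v)) =
      -∑ r, ∑ p, (C j r * C i p) • W p r := by
    have h1 : ∑ q, δC j q v • D i (A q v) = -∑ r, C j r • ∑ s, δB r s v • D i (D s v) := by
      have := congrArg (D i) (hδA j v v)
      simpa only [map_sum, map_smul, map_neg] using this
    rw [Finset.sum_sub_distrib, hδA, h1, ← sub_eq_zero]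
    have h2 (r : Fin n) : ∑ s, δB r s (D i v) • D s v - ∑ s, δB r s v • D i (D s v) =
        ∑ p, C i p • W p r := by
      simp only [hWdef, hD i, map_sum, map_smul, Finset.sum_smul, Finset.smul_sum, smul_sub,
        Finset.sum_sub_distrib, smul_eq_mul, smul_smul]
      congr 1
      · rw [Finset.sum_comm]
      · rw [Finset.sum_comm]
        exact Finset.sum_congr rfl fun p _ => Finset.sum_congr rfl fun s _ => by rw [mul_comm]
    have h3 : ∑ r, ∑ p, (C j r * C i p) • W p r = ∑ r, C j r • ∑ p, C i p • W p r := by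
      simp only [Finset.smul_sum, smul_smul]
    rw [h3]
    simp only [← h2, smul_sub, Finset.sum_sub_distrib]
    abel
  -- Absorbing `∑ C j q A q = D j` shows that the first sum is minus the second one with `i` and `j`
  -- exchanged. Both become contractions of `W`, which cancel by its symmetry.
  have hx : ∑ q, C j q • -(∑ p, (δC i p (A q v) • A p v - δC i p v • A q (A p v))) =
      -∑ q, (δC i q (D j v) • A q v - δC i q v • D j (A q v)) := by
    simp only [hD j, map_sum, map_smul, Finset.sum_smul, Finset.smul_sum, smul_sub, smul_neg,
      Finset.sum_sub_distrib, Finset.sum_neg_distrib, smul_eq_mul, smul_smul]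
    congr 2
    · rw [Finset.sum_comm]
    · rw [Finset.sum_comm]
      exact Finset.sum_congr rfl fun p _ => Finset.sum_congr rfl fun s _ => by rw [mul_comm]
  rw [hx, hy, hy, Finset.sum_comm, neg_neg, ← sub_eq_add_neg, sub_eq_zero]
  exact Finset.sum_congr rfl fun p _ => Finset.sum_congr rfl fun r _ => by rw [hW, mul_comm]

end DualVariation

/-! ### The dual basis consists of mutual symmetries. -/

section DualSymmetries

variable {n : ℕ} {X : Type*} [TopologicalSpace X] [ChartedSpace (EuclideanSpace ℝ (Fin n)) X]
  [IsManifold (𝓡 n) ∞ X] {K : Fin n → OpField n X} (hK : IsOperatorFrobeniusAlgebra K)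
include hK

lemma mdifferentiableAt_structureFun (i j k : Fin n) (x : X) :
    MDifferentiableAt (𝓡 n) 𝓘(ℝ, ℝ) (fun y => structureFun K i j y k) x :=
  (smoothFunOn_structureFun hK i j k).mdifferentiableAt isOpen_univ (mem_univ x)

lemma differential_structureFun_symm (hsym : MutualSymmetriesOn univ K) (x : X)
    (p r l k : Fin n) (v : TangentSpace (𝓡 n) x) :
    differential n (fun y => structureFun K r l y k) x (K p x v) -
        ∑ s, differential n (fun y => structureFun K r l y s) x v * structureFun K p s x k =
      differential n (fun y => structureFun K p l y k) x (K r x v) -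
        ∑ s, differential n (fun y => structureFun K p l y s) x v * structureFun K r s x k := by
  -- Two evaluations of `⟨K_p, K_r K_l⟩(ξ, ξ)`: by `bracketTensor_comp`, and by expanding the
  -- product in the basis with the structure functions as coefficients.
  have key (p r : Fin n) {V : Set X} (hV : IsOpen V) {ξ : VField n X} (hξ : SmoothVFieldOn V ξ)
      (hx : x ∈ V) : bracketTensor (K p) (K r) ξ (applyOp (K l) ξ) x =
        ∑ j, (differential n (fun y => structureFun K r l y j) x (K p x (ξ x)) -
          ∑ s, differential n (fun y => structureFun K r l y s) x (ξ x) *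
            structureFun K p s x j) • K j x (ξ x) := by
    have h1 := bracketTensor_comp (P := K l) (hK.commute p r x) ξ
    rw [(hsym p l).bracketTensor_self hV (subset_univ V) hξ hx, map_zero, add_zero] at h1
    rw [← h1]
    have h2 : (fun y => (K r y).comp (K l y)) = combination (fun j y => structureFun K r l y j) K :=
      funext fun y => comp_eq_sum_structureFun hK y r l
    rw [h2, bracketTensor_combination_of_isSymmetryOn (hsym p) hV (subset_univ V)
      (fun j => (smoothFunOn_structureFun hK r l j).mono (subset_univ V)) hξ hx]
    simp only [sub_smul, Finset.sum_sub_distrib, Finset.sum_smul]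
    congr 1
    have h3 (s : Fin n) (w : TangentSpace (𝓡 n) x) :
        K p x (K s x w) = ∑ j, structureFun K p s x j • K j x w := by
      have := congrArg (fun C : TangentSpace (𝓡 n) x →L[ℝ] TangentSpace (𝓡 n) x => C w)
        (comp_eq_sum_structureFun hK x p s)
      simpa using this
    simp only [h3, Finset.smul_sum, smul_smul]
    rw [Finset.sum_comm]
  have key2 (p r : Fin n) (ξ : VField n X) {V : Set X} (hV : IsOpen V) (hξ : SmoothVFieldOn V ξ)
      (hx : x ∈ V) : bracketTensor (K p) (K r) ξ (applyOp (K l) ξ) x =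
        bracketTensor (K r) (K p) ξ (applyOp (K l) ξ) x := by
    have hη : SmoothVFieldOn V (applyOp (K l) ξ) :=
      ((hK.smooth l).mono (subset_univ V)).applyOp hξ
    rw [bracketTensor_swap (hK.commute p r x), neg_eq_iff_add_eq_zero, add_comm]
    exact (hsym r p).symm_part V hV (subset_univ V) _ _ hξ hη x hx
  obtain ⟨ζ, hζ⟩ := hK.exists_generic_vector x
  set φ : Fin n → TangentSpace (𝓡 n) x →L[ℝ] ℝ := fun k =>
    ((differential n (fun y => structureFun K r l y k) x).comp (K p x) -
        ∑ s, structureFun K p s x k • differential n (fun y => structureFun K r l y s) x) -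
      ((differential n (fun y => structureFun K p l y k) x).comp (K r x) -
        ∑ s, structureFun K r s x k • differential n (fun y => structureFun K p l y s) x) with hφ
  have hφa (k : Fin n) (v : TangentSpace (𝓡 n) x) : φ k v =
      (differential n (fun y => structureFun K r l y k) x (K p x v) -
        ∑ s, differential n (fun y => structureFun K r l y s) x v * structureFun K p s x k) -
      (differential n (fun y => structureFun K p l y k) x (K r x v) -
        ∑ s, differential n (fun y => structureFun K p l y s) x v * structureFun K r s x k) := by
    simp [hφ, mul_comm]
  have h0 : φ k = 0 := by
    refine forms_eq_zero_of_sum_smul_apply_eq_zero hζ (fun v => ?_) k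
    obtain ⟨V, hV, hxV, -, ξ, hξ, rfl⟩ := exists_smoothVField_eq isOpen_univ (mem_univ x) v
    have := key2 p r ξ hV hξ hxV
    rw [key p r hV hξ hxV, key r p hV hξ hxV, ← sub_eq_zero, ← Finset.sum_sub_distrib] at this
    rw [← this]
    exact Finset.sum_congr rfl fun j _ => by rw [hφa, sub_smul]
  rw [← sub_eq_zero, ← hφa, h0]
  rfl

lemma differential_frobeniusForm_symm (hsym : MutualSymmetriesOn univ K) (a : Fin n → ℝ) (x : X)
    (p r l : Fin n) (v : TangentSpace (𝓡 n) x) :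
    differential n (fun y => frobeniusForm K a y r l) x (K p x v) -
        ∑ s, differential n (fun y => frobeniusForm K a y r s) x v * structureFun K p l x s =
      differential n (fun y => frobeniusForm K a y p l) x (K r x v) -
        ∑ s, differential n (fun y => frobeniusForm K a y p s) x v * structureFun K r l x s := by
  have dB (i j : Fin n) (w : TangentSpace (𝓡 n) x) :
      differential n (fun y => frobeniusForm K a y i j) x w =
        ∑ k, a k * differential n (fun y => structureFun K i j y k) x w := by
    have h : (fun y => frobeniusForm K a y i j) = fun y => ∑ k, a k * structureFun K i j y k :=
      funext fun y => by simp [frobeniusForm_apply, mul_comm]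
    rw [h, differential_linearCombination a fun k => mdifferentiableAt_structureFun hK i j k x]
    simp
  have dprod (i j q k : Fin n) (w : TangentSpace (𝓡 n) x) :
      differential n (fun y => ∑ s, structureFun K i j y s * structureFun K q s y k) x w =
        ∑ s, (structureFun K i j x s * differential n (fun y => structureFun K q s y k) x w +
          structureFun K q s x k * differential n (fun y => structureFun K i j y s) x w) := by
    exact differential_sum_mul (f := fun s y => structureFun K i j y s)
      (g := fun s y => structureFun K q s y k) (fun s => mdifferentiableAt_structureFun hK i j s x)
      (fun s => mdifferentiableAt_structureFun hK q s k x) w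
  have assoc (k : Fin n) :
      ∑ s, (structureFun K r l x s * differential n (fun y => structureFun K p s y k) x v +
          structureFun K p s x k * differential n (fun y => structureFun K r l y s) x v) =
      ∑ s, (structureFun K p l x s * differential n (fun y => structureFun K r s y k) x v +
          structureFun K r s x k * differential n (fun y => structureFun K p l y s) x v) := by
    rw [← dprod r l p k v, ← dprod p l r k v]
    congr 3
    funext y
    obtain ⟨ξ, hξ⟩ := hK.exists_generic_vector y
    exact structureConstants_assoc (comp_eq_sum_structureFun hK y) (fun i j => hK.commute i j y)
      hξ p r l k
  -- Differentiated associativity replaces the terms `da_{rl}^s · a_{ps}^k` by terms `da_{rs}^k ·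
  -- a_{pl}^s`, so that every differential now carries the free upper index `k`.
  have main (k : Fin n) :
      differential n (fun y => structureFun K r l y k) x (K p x v) -
        ∑ s, differential n (fun y => structureFun K r s y k) x v * structureFun K p l x s =
      differential n (fun y => structureFun K p l y k) x (K r x v) -
        ∑ s, differential n (fun y => structureFun K p s y k) x v * structureFun K r l x s := by
    have h1 := differential_structureFun_symm hK hsym x p r l k v
    have h2 := assoc k
    simp only [Finset.sum_add_distrib] at h2
    simp only [mul_comm (differential n _ x v)] at h1 ⊢
    linarith
  -- Contraction over `k` commutes with the differential because the `a k` are constants.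
  have e (p r : Fin n) : differential n (fun y => frobeniusForm K a y r l) x (K p x v) -
        ∑ s, differential n (fun y => frobeniusForm K a y r s) x v * structureFun K p l x s =
      ∑ k, a k * (differential n (fun y => structureFun K r l y k) x (K p x v) -
        ∑ s, differential n (fun y => structureFun K r s y k) x v * structureFun K p l x s) := by
    simp only [dB, mul_sub, Finset.sum_sub_distrib, Finset.sum_mul, Finset.mul_sum, mul_assoc]
    congr 1
    rw [Finset.sum_comm]
  rw [e, e]
  exact Finset.sum_congr rfl fun k _ => by rw [main]

lemma dualBasis_commute {a : Fin n → ℝ} (i j : Fin n) (x : X) :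
    (dualBasis K a i x).comp (dualBasis K a j x) = (dualBasis K a j x).comp (dualBasis K a i x) :=
  dual_commute_dual (A := fun i => K i x) (B := frobeniusForm K a x) (fun i j => hK.commute i j x)
    (fun _ => rfl) i j

theorem mutualSymmetriesOn_dualBasis (hsym : MutualSymmetriesOn univ K) {a : Fin n → ℝ}
    (ha : ∀ x, (frobeniusForm K a x).det ≠ 0) : MutualSymmetriesOn univ (dualBasis K a) := by
  intro i j
  have hM (i : Fin n) := smoothOpFieldOn_dualBasis hK ha i
  refine (isSymmetryOn_iff (hM i) (hM j) fun x _ => dualBasis_commute hK i j x).2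
    fun V hV hVU ξ hξ x hx => ?_
  obtain ⟨ζ, hζ⟩ := hK.exists_generic_vector x
  have hC (i j : Fin n) : SmoothFunOn n V (fun x => (frobeniusForm K a x)⁻¹ i j) :=
    (smoothFunOn_frobeniusForm_inv hK ha i j).mono hVU
  have hcomm : ∀ i j, (K i x).comp (K j x) = (K j x).comp (K i x) := fun i j => hK.commute i j x
  have hDA (i : Fin n) : dualBasis K a i x = ∑ j, (frobeniusForm K a x)⁻¹ i j • K j x := rfl
  have h1 (q : Fin n) : bracketTensor (dualBasis K a i) (K q) ξ ξ x =
      -∑ p, (differential n (fun x => (frobeniusForm K a x)⁻¹ i p) x (K q x (ξ x)) • K p x (ξ x) -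
        differential n (fun x => (frobeniusForm K a x)⁻¹ i p) x (ξ x) • K q x (K p x (ξ x))) := by
    -- The swap puts `M^i` into the second slot, where it can be expanded as a combination of
    -- symmetries of `K_q`.
    rw [bracketTensor_swap (dual_commute hcomm hDA q i).symm, dualBasis_eq_combination,
      bracketTensor_combination_of_isSymmetryOn (hsym q) hV hVU (fun p => hC i p) hξ hx]
  rw [dualBasis_eq_combination K a j, bracketTensor_combination hV (fun p => hC j p)
    (fun p => (hK.smooth p).mono hVU) hξ hx]
  simp only [h1]
  refine dual_variation_eq_zero (A := fun i => K i x) (D := fun i => dualBasis K a i x)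
    (c := fun i j => structureFun K i j x) (B := frobeniusForm K a x) (C := (frobeniusForm K a x)⁻¹)
    (δB := fun i j => differential n (fun y => frobeniusForm K a y i j) x)
    (δC := fun i j => differential n (fun y => (frobeniusForm K a y)⁻¹ i j) x)
    (fun p => (sum_smul_dual (ha x) hDA p).symm) hDA
    (comp_dual (comp_eq_sum_structureFun hK x) hcomm hζ (frobeniusForm_apply K a x) (ha x) hDA)
    (fun i m v => ?_) (differential_frobeniusForm_symm hK hsym a x) i j (ξ x)
  have hCd (i j : Fin n) := (hC i j).mdifferentiableAt hV hx
  have hBd (i j : Fin n) :=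
    (smoothFunOn_frobeniusForm hK a i j).mdifferentiableAt isOpen_univ (mem_univ x)
  have h2 : differential n (fun y => ∑ j, (frobeniusForm K a y)⁻¹ i j * frobeniusForm K a y j m) x
      = 0 := by
    simp only [mul_sum_inv (ha _)]
    exact differential_const _ x
  have h3 := differential_sum_mul (f := fun j y => (frobeniusForm K a y)⁻¹ i j)
    (g := fun j y => frobeniusForm K a y j m) (fun j => hCd i j) (fun j => hBd j m) v
  rw [h2, zero_apply] at h3
  rw [h3]
  exact Finset.sum_congr rfl fun j _ => by ring

end DualSymmetries

/-! ### Closed forms in charts and the Poincaré lemma. -/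

section ExteriorDerivative

variable {n : ℕ} {X : Type*} [TopologicalSpace X] [ChartedSpace (EuclideanSpace ℝ (Fin n)) X]

lemma isOpen_chart_source (x : X) : IsOpen (extChartAt (𝓡 n) x).source := isOpen_extChartAt_source x

variable [IsManifold (𝓡 n) ∞ X] {U : Set X}

lemma minSmoothness_two_le : minSmoothness ℝ 2 ≤ ∞ := by
  rw [minSmoothness_of_isRCLikeNormedField]
  exact WithTop.coe_le_coe.2 (le_top : (2 : ℕ∞) ≤ ⊤)

lemma SmoothFunOn.differential_apply {f : X → ℝ} {ξ : VField n X} (hU : IsOpen U)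
    (hf : SmoothFunOn n U f) (hξ : SmoothVFieldOn U ξ) :
    SmoothFunOn n U (fun y => differential n f y (ξ y)) := by
  have h1 := ContMDiffOn.contMDiffOn_tangentMapWithin (m := ∞) hf (by simp) hU.uniqueMDiffOn
  have h2 := h1.comp hξ (fun y hy => hy)
  have h3 := (contMDiff_snd_tangentBundle_modelSpace ℝ 𝓘(ℝ, ℝ) (n := ∞)).comp_contMDiffOn h2
  refine h3.congr fun y hy => ?_
  have h4 : mfderivWithin (𝓡 n) 𝓘(ℝ, ℝ) f U y = mfderiv (𝓡 n) 𝓘(ℝ, ℝ) f y :=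
    mfderivWithin_of_isOpen hU hy
  exact (congrArg (fun L : EuclideanSpace ℝ (Fin n) →L[ℝ] ℝ => L (ξ y)) h4).symm

lemma contMDiffAt_chart {x y : X} (hy : y ∈ (extChartAt (𝓡 n) x).source) :
    ContMDiffAt (𝓡 n) 𝓘(ℝ, EuclideanSpace ℝ (Fin n)) ∞ (extChartAt (𝓡 n) x) y :=
  contMDiffAt_extChartAt' (by rwa [extChartAt_source] at hy)

lemma differential_comp_chart {x y : X} (hy : y ∈ (extChartAt (𝓡 n) x).source)
    {g : EuclideanSpace ℝ (Fin n) → ℝ} (hg : DifferentiableAt ℝ g (extChartAt (𝓡 n) x y))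
    (w : TangentSpace (𝓡 n) y) :
    differential n (fun z => g (extChartAt (𝓡 n) x z)) y w =
      fderiv ℝ g (extChartAt (𝓡 n) x y)
        (mfderiv (𝓡 n) 𝓘(ℝ, EuclideanSpace ℝ (Fin n)) (extChartAt (𝓡 n) x) y w) := by
  have h := mvfderiv_comp_apply (I := 𝓡 n) y hg.mdifferentiableAt
    ((contMDiffAt_chart hy).mdifferentiableAt (by simp)) w
  refine h.trans ?_
  have h2 := mfderiv_eq_fderiv (𝕜 := ℝ) (f := g) (x := extChartAt (𝓡 n) x y)
  exact congrArg (fun L : EuclideanSpace ℝ (Fin n) →L[ℝ] ℝ => L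
    (mfderiv (𝓡 n) 𝓘(ℝ, EuclideanSpace ℝ (Fin n)) (extChartAt (𝓡 n) x) y w)) h2

/-- The vector field with constant components `v` in the chart at `x`. -/
noncomputable def coordField (x : X) (v : EuclideanSpace ℝ (Fin n)) : VField n X :=
  VectorField.mpullback (𝓡 n) 𝓘(ℝ, EuclideanSpace ℝ (Fin n)) (extChartAt (𝓡 n) x) (fun _ => v)

lemma mfderiv_chart_coordField {x y : X} (hy : y ∈ (extChartAt (𝓡 n) x).source)
    (v : EuclideanSpace ℝ (Fin n)) :
    mfderiv (𝓡 n) 𝓘(ℝ, EuclideanSpace ℝ (Fin n)) (extChartAt (𝓡 n) x) y (coordField x v y) = v :=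
  (isInvertible_mfderiv_extChartAt hy).self_apply_inverse v

lemma coordField_mfderiv_chart {x y : X} (hy : y ∈ (extChartAt (𝓡 n) x).source)
    (w : TangentSpace (𝓡 n) y) :
    coordField x (mfderiv (𝓡 n) 𝓘(ℝ, EuclideanSpace ℝ (Fin n)) (extChartAt (𝓡 n) x) y w) y = w :=
  (isInvertible_mfderiv_extChartAt hy).inverse_apply_self w

lemma smoothVFieldOn_coordField (x : X) (v : EuclideanSpace ℝ (Fin n)) :
    SmoothVFieldOn (extChartAt (𝓡 n) x).source (coordField x v) := by
  intro y hy
  refine (ContMDiffAt.mpullback_vectorField_preimage (n := ∞) ?_ (contMDiffAt_chart hy)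
    (isInvertible_mfderiv_extChartAt hy) (by simp)).contMDiffWithinAt
  exact contMDiffAt_vectorSpace_iff_contDiffAt.2 contDiffAt_const

lemma mlieBracket_modelSpace (V W : ∀ z : EuclideanSpace ℝ (Fin n), TangentSpace (𝓡 n) z)
    (z : EuclideanSpace ℝ (Fin n)) :
    VectorField.mlieBracket (𝓡 n) V W z = VectorField.lieBracket ℝ V W z := by
  have h := congrFun (VectorField.mlieBracketWithin_eq_lieBracketWithin (𝕜 := ℝ) (V := V) (W := W)
    (s := univ)) z
  rw [VectorField.mlieBracketWithin_univ] at h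
  exact h.trans (congrFun (VectorField.lieBracketWithin_univ (𝕜 := ℝ) (V := V) (W := W)) z)

lemma bracket_eq_of_chart {x : X} {V W : EuclideanSpace ℝ (Fin n) → EuclideanSpace ℝ (Fin n)}
    {y : X} (hy : y ∈ (extChartAt (𝓡 n) x).source)
    (hV : ContDiffAt ℝ ∞ V (extChartAt (𝓡 n) x y))
    (hW : ContDiffAt ℝ ∞ W (extChartAt (𝓡 n) x y)) :
    bracket (fun z => coordField x (V (extChartAt (𝓡 n) x z)) z)
      (fun z => coordField x (W (extChartAt (𝓡 n) x z)) z) y =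
      coordField x (VectorField.lieBracket ℝ V W (extChartAt (𝓡 n) x y)) y := by
  have : IsManifold (𝓡 n) (minSmoothness ℝ 2) X := IsManifold.of_le minSmoothness_two_le
  have h := VectorField.mpullback_mlieBracket (n := ∞)
    ((contMDiffAt_vectorSpace_iff_contDiffAt.2 hV).mdifferentiableAt (by simp))
    ((contMDiffAt_vectorSpace_iff_contDiffAt.2 hW).mdifferentiableAt (by simp))
    (contMDiffAt_chart hy) minSmoothness_two_le
  refine h.symm.trans ?_
  exact congrArg (fun v => coordField x v y) (mlieBracket_modelSpace V W _)

lemma bracket_coordField {x y : X} (hy : y ∈ (extChartAt (𝓡 n) x).source)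
    (u v : EuclideanSpace ℝ (Fin n)) : bracket (coordField x u) (coordField x v) y = 0 := by
  have h := bracket_eq_of_chart (V := fun _ => u) (W := fun _ => v) hy
    contDiffAt_const contDiffAt_const
  refine h.trans ?_
  have : VectorField.lieBracket ℝ (fun _ : EuclideanSpace ℝ (Fin n) => u) (fun _ => v)
      (extChartAt (𝓡 n) x y) = 0 := by
    simp [VectorField.lieBracket]
  rw [this]
  exact map_zero (mfderiv (𝓡 n) 𝓘(ℝ, EuclideanSpace ℝ (Fin n)) (extChartAt (𝓡 n) x) y).inverse

lemma exists_chart_representation (hU : IsOpen U) {ξ : VField n X} (hξ : SmoothVFieldOn U ξ)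
    {x : X} (hx : x ∈ U) : ∃ V : EuclideanSpace ℝ (Fin n) → EuclideanSpace ℝ (Fin n),
      ContDiffAt ℝ ∞ V (extChartAt (𝓡 n) x x) ∧
        ∀ᶠ y in 𝓝 x, ξ y = coordField x (V (extChartAt (𝓡 n) x y)) y := by
  let w : X → EuclideanSpace ℝ (Fin n) := fun y =>
    mfderiv (𝓡 n) 𝓘(ℝ, EuclideanSpace ℝ (Fin n)) (extChartAt (𝓡 n) x) y (ξ y)
  refine ⟨fun z => w ((extChartAt (𝓡 n) x).symm z), ?_, ?_⟩
  · have hxs : x ∈ (extChartAt (𝓡 n) x).source := mem_extChartAt_source x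
    have h0 : ContMDiffOn (𝓡 n) 𝓘(ℝ, EuclideanSpace ℝ (Fin n)) ∞ (extChartAt (𝓡 n) x)
        (extChartAt (𝓡 n) x).source := fun y hy => (contMDiffAt_chart hy).contMDiffWithinAt
    have h1 := h0.contMDiffOn_tangentMapWithin (m := ∞) (by simp)
      (isOpen_chart_source x).uniqueMDiffOn
    have h2 := h1.comp (hξ.mono (inter_subset_left (t := (extChartAt (𝓡 n) x).source)))
      (fun y hy => hy.2)
    have h3 := (contMDiff_snd_tangentBundle_modelSpace (EuclideanSpace ℝ (Fin n))
      𝓘(ℝ, EuclideanSpace ℝ (Fin n)) (n := ∞)).comp_contMDiffOn h2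
    have h3' : ContMDiffOn (𝓡 n) 𝓘(ℝ, EuclideanSpace ℝ (Fin n)) ∞ w
        (U ∩ (extChartAt (𝓡 n) x).source) := by
      refine h3.congr fun y hy => ?_
      have h8 : mfderivWithin (𝓡 n) 𝓘(ℝ, EuclideanSpace ℝ (Fin n)) (extChartAt (𝓡 n) x)
          (extChartAt (𝓡 n) x).source y =
          mfderiv (𝓡 n) 𝓘(ℝ, EuclideanSpace ℝ (Fin n)) (extChartAt (𝓡 n) x) y :=
        mfderivWithin_of_isOpen (isOpen_chart_source x) hy.2
      exact (congrArg (fun L : EuclideanSpace ℝ (Fin n) →L[ℝ] EuclideanSpace ℝ (Fin n) =>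
        L (ξ y)) h8).symm
    have h4 := h3'.contMDiffAt ((hU.inter (isOpen_chart_source x)).mem_nhds ⟨hx, hxs⟩)
    have h5 : ContMDiffAt 𝓘(ℝ, EuclideanSpace ℝ (Fin n)) (𝓡 n) ∞ (extChartAt (𝓡 n) x).symm
        (extChartAt (𝓡 n) x x) :=
      (contMDiffOn_extChartAt_symm x).contMDiffAt (extChartAt_target_mem_nhds x)
    exact contMDiffAt_iff_contDiffAt.1 (h4.comp_of_eq h5 (extChartAt_to_inv x))
  · filter_upwards [(isOpen_chart_source (n := n) x).mem_nhds (mem_extChartAt_source x)] with y hy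
    rw [(extChartAt (𝓡 n) x).left_inv hy]
    exact (coordField_mfderiv_chart hy (ξ y)).symm

lemma SmoothFunOn.contDiffAt_chart_symm {f : X → ℝ} (hU : IsOpen U) (hf : SmoothFunOn n U f)
    {x : X} {z : EuclideanSpace ℝ (Fin n)} (hz : z ∈ (extChartAt (𝓡 n) x).target)
    (hzU : (extChartAt (𝓡 n) x).symm z ∈ U) :
    ContDiffAt ℝ ∞ (fun z => f ((extChartAt (𝓡 n) x).symm z)) z := by
  have h5 : ContMDiffAt 𝓘(ℝ, EuclideanSpace ℝ (Fin n)) (𝓡 n) ∞ (extChartAt (𝓡 n) x).symm z :=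
    (contMDiffOn_extChartAt_symm x).contMDiffAt ((isOpen_extChartAt_target x).mem_nhds hz)
  exact contMDiffAt_iff_contDiffAt.1 (ContMDiffAt.comp z
    (ContMDiffOn.contMDiffAt hf (hU.mem_nhds hzU)) h5)

/-- The differential of a smooth function is closed. -/
lemma isClosedFormOn_differential {f : X → ℝ} (hf : SmoothFunOn n U f) :
    IsClosedFormOn U (differential n f) := by
  intro V hV hVU ξ η hξ hη x hx
  obtain ⟨V', hV', hξV⟩ := exists_chart_representation hV hξ hx
  obtain ⟨W', hW', hηW⟩ := exists_chart_representation hV hη hx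
  have hxs : x ∈ (extChartAt (𝓡 n) x).source := mem_extChartAt_source x
  have hfV : SmoothFunOn n V f := hf.mono hVU
  set g : EuclideanSpace ℝ (Fin n) → ℝ := fun z => f ((extChartAt (𝓡 n) x).symm z) with hg
  have hgd {y : X} (hy : y ∈ V) (hys : y ∈ (extChartAt (𝓡 n) x).source) :
      ContDiffAt ℝ ∞ g (extChartAt (𝓡 n) x y) :=
    hfV.contDiffAt_chart_symm hV ((extChartAt (𝓡 n) x).map_source hys)
      (by rwa [(extChartAt (𝓡 n) x).left_inv hys])
  have hnhds : ∀ᶠ y in 𝓝 x, y ∈ V ∧ y ∈ (extChartAt (𝓡 n) x).source :=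
    (hV.mem_nhds hx |> Filter.Eventually.and <| (isOpen_chart_source x).mem_nhds hxs)
  have hdf {y : X} (hy : y ∈ V) (hys : y ∈ (extChartAt (𝓡 n) x).source)
      (v : EuclideanSpace ℝ (Fin n)) :
      differential n f y (coordField x v y) = fderiv ℝ g (extChartAt (𝓡 n) x y) v := by
    have h1 : differential n f y = differential n (fun z => g (extChartAt (𝓡 n) x z)) y := by
      refine differential_congr ?_
      filter_upwards [(isOpen_chart_source (n := n) x).mem_nhds hys] with z hz
      simp only [hg, (extChartAt (𝓡 n) x).left_inv hz]
    rw [h1, differential_comp_chart hys ((hgd hy hys).differentiableAt (by simp)),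
      mfderiv_chart_coordField hys]
  have hg2 : DifferentiableAt ℝ (fderiv ℝ g) (extChartAt (𝓡 n) x x) :=
    ((hgd hx hxs).fderiv_right (m := 1) (by norm_cast)).differentiableAt (by simp)
  have hdd {ζ ρ : VField n X} {Z R : EuclideanSpace ℝ (Fin n) → EuclideanSpace ℝ (Fin n)}
      (hZ : ContDiffAt ℝ ∞ Z (extChartAt (𝓡 n) x x))
      (hζ : ∀ᶠ y in 𝓝 x, ζ y = coordField x (Z (extChartAt (𝓡 n) x y)) y)
      (hρ : ∀ᶠ y in 𝓝 x, ρ y = coordField x (R (extChartAt (𝓡 n) x y)) y) :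
      differential n (fun y => differential n f y (ζ y)) x (ρ x) =
        fderiv ℝ (fderiv ℝ g) (extChartAt (𝓡 n) x x) (R (extChartAt (𝓡 n) x x))
            (Z (extChartAt (𝓡 n) x x)) +
          fderiv ℝ g (extChartAt (𝓡 n) x x)
            (fderiv ℝ Z (extChartAt (𝓡 n) x x) (R (extChartAt (𝓡 n) x x))) := by
    replace hZ : DifferentiableAt ℝ Z (extChartAt (𝓡 n) x x) := hZ.differentiableAt (by simp)
    have h1 : differential n (fun y => differential n f y (ζ y)) x =
        differential n (fun y => (fun z => fderiv ℝ g z (Z z)) (extChartAt (𝓡 n) x y)) x := by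
      refine differential_congr ?_
      filter_upwards [hnhds, hζ] with y hy hyζ
      rw [hyζ, hdf hy.1 hy.2]
    rw [h1, differential_comp_chart hxs (hg2.clm_apply hZ), hρ.self_of_nhds,
      mfderiv_chart_coordField hxs, fderiv_clm_apply hg2 hZ]
    simp [add_comm]
  have hbr : bracket ξ η x =
      coordField x (VectorField.lieBracket ℝ V' W' (extChartAt (𝓡 n) x x)) x := by
    rw [bracket_congr hξV hηW, bracket_eq_of_chart hxs hV' hW']
  -- In the chart the second derivatives of `g` cancel by symmetry, and the derivatives of the
  -- components are matched by the commutator term.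
  have hsymm := (hgd hx hxs).isSymmSndFDerivAt minSmoothness_two_le
  rw [extDerivForm, hdd hW' hηW hξV, hdd hV' hξV hηW, hbr, hdf hx hxs,
    hsymm (V' (extChartAt (𝓡 n) x x)) (W' (extChartAt (𝓡 n) x x))]
  simp only [VectorField.lieBracket, map_sub]
  ring

lemma IsClosedFormOn.congr {α α' : OneForm n X} (h : IsClosedFormOn U α)
    (hαα' : ∀ x ∈ U, α x = α' x) : IsClosedFormOn U α' := by
  intro V hV hVU ξ η hξ hη x hx
  have e (ζ : VField n X) : differential n (fun y => α' y (ζ y)) x =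
      differential n (fun y => α y (ζ y)) x := by
    refine differential_congr ?_
    filter_upwards [hV.mem_nhds hx] with y hy
    rw [hαα' y (hVU hy)]
  have := h V hV hVU ξ η hξ hη x hx
  rw [extDerivForm] at this ⊢
  rw [e, e, ← hαα' x (hVU hx), this]

lemma isClosedFormOn_of_local {α : OneForm n X}
    (h : ∀ x ∈ U, ∃ V : Set X, IsOpen V ∧ x ∈ V ∧ IsClosedFormOn V α) : IsClosedFormOn U α := by
  intro V hV hVU ξ η hξ hη x hx
  obtain ⟨W, hW, hxW, hα⟩ := h x (hVU hx)
  exact hα (V ∩ W) (hV.inter hW) inter_subset_right ξ η (hξ.mono inter_subset_left)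
    (hη.mono inter_subset_left) x ⟨hx, hxW⟩

/-- The Poincaré lemma: a smooth closed `1`-form is locally the differential of a function. -/
lemma IsClosedFormOn.exists_differential_eq {α : OneForm n X} (hU : IsOpen U)
    (hα : IsClosedFormOn U α)
    (hs : ∀ V : Set X, IsOpen V → V ⊆ U → ∀ ξ : VField n X, SmoothVFieldOn V ξ →
      SmoothFunOn n V (fun y => α y (ξ y))) {x : X} (hx : x ∈ U) :
    ∃ V : Set X, IsOpen V ∧ x ∈ V ∧ V ⊆ U ∧ ∃ f : X → ℝ, SmoothFunOn n V f ∧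
      ∀ y ∈ V, α y = differential n f y := by
  set φ := extChartAt (𝓡 n) x with hφ
  have hxs : x ∈ φ.source := mem_extChartAt_source x
  set S : Set X := φ.source ∩ U with hS
  have hSo : IsOpen S := (isOpen_chart_source x).inter hU
  have hT : φ.target ∩ φ.symm ⁻¹' U ∈ 𝓝 (φ x) := by
    refine Filter.inter_mem (extChartAt_target_mem_nhds x) ?_
    refine (continuousAt_extChartAt_symm x).preimage_mem_nhds ?_
    rw [extChartAt_to_inv]
    exact hU.mem_nhds hx
  obtain ⟨r, hr, hball⟩ := Metric.mem_nhds_iff.1 hT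
  -- The coordinate expression of `α`. Coordinate fields commute, so closedness tested on them says
  -- that the derivative of `θ` is symmetric; on a ball `θ` then has a primitive.
  set θ : EuclideanSpace ℝ (Fin n) → EuclideanSpace ℝ (Fin n) →L[ℝ] ℝ := fun z =>
    (α (φ.symm z)).comp
      (mfderiv (𝓡 n) 𝓘(ℝ, EuclideanSpace ℝ (Fin n)) φ (φ.symm z)).inverse with hθ
  have hθφ {y : X} (hy : y ∈ φ.source) (v : EuclideanSpace ℝ (Fin n)) :
      θ (φ y) v = α y (coordField x v y) := by
    have h : ∀ y', y' = y → α y' (coordField x v y') = α y (coordField x v y) := by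
      rintro _ rfl
      rfl
    exact h _ (φ.left_inv hy)
  have hgs (v : EuclideanSpace ℝ (Fin n)) :
      SmoothFunOn n S (fun y => α y (coordField x v y)) :=
    hs S hSo inter_subset_right _ ((smoothVFieldOn_coordField x v).mono inter_subset_left)
  have hθs : ContDiffOn ℝ ∞ θ (Metric.ball (φ x) r) := by
    refine contDiffOn_clm_apply.2 fun v z hz => ?_
    exact ((hgs v).contDiffAt_chart_symm hSo (hball hz).1
      ⟨φ.map_target (hball hz).1, (hball hz).2⟩).contDiffWithinAt
  have hθd {z : EuclideanSpace ℝ (Fin n)} (hz : z ∈ Metric.ball (φ x) r) :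
      DifferentiableAt ℝ θ z :=
    (hθs.contDiffAt (Metric.isOpen_ball.mem_nhds hz)).differentiableAt (by simp)
  have hsymm : ∀ z ∈ Metric.ball (φ x) r, ∀ u v, fderiv ℝ θ z u v = fderiv ℝ θ z v u := by
    intro z hz
    obtain ⟨hzt, hzU⟩ := hball hz
    have hys : φ.symm z ∈ φ.source := φ.map_target hzt
    have key (u v : EuclideanSpace ℝ (Fin n)) :
        differential n (fun y => α y (coordField x v y)) (φ.symm z) (coordField x u (φ.symm z)) =
          fderiv ℝ θ z u v := by
      have h1 : differential n (fun y => α y (coordField x v y)) (φ.symm z) =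
          differential n (fun y => (fun z => θ z v) (φ y)) (φ.symm z) := by
        refine differential_congr ?_
        filter_upwards [(isOpen_chart_source (n := n) x).mem_nhds hys] with y hy
        exact (hθφ hy v).symm
      have hd : DifferentiableAt ℝ θ (φ (φ.symm z)) := by
        rw [φ.right_inv hzt]; exact hθd hz
      rw [h1, differential_comp_chart hys (hd.clm_apply (differentiableAt_const v)),
        mfderiv_chart_coordField hys, φ.right_inv hzt,
        fderiv_clm_apply (hθd hz) (differentiableAt_const v)]
      simp
    intro u v
    have h := hα S hSo inter_subset_right (coordField x u) (coordField x v)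
      ((smoothVFieldOn_coordField x u).mono inter_subset_left)
      ((smoothVFieldOn_coordField x v).mono inter_subset_left) (φ.symm z) ⟨hys, hzU⟩
    rw [extDerivForm, key, key, bracket_coordField hys, map_zero, sub_zero, sub_eq_zero] at h
    exact h
  obtain ⟨g, hg⟩ := (convex_ball (φ x) r).exists_forall_hasFDerivAt_of_fderiv_symmetric
    Metric.isOpen_ball (fun z hz => (hθd hz).differentiableWithinAt) hsymm
  have hgs' : ContDiffOn ℝ ∞ g (Metric.ball (φ x) r) := by
    rw [contDiffOn_infty_iff_fderiv_of_isOpen Metric.isOpen_ball]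
    exact ⟨fun z hz => (hg z hz).differentiableAt.differentiableWithinAt,
      hθs.congr fun z hz => (hg z hz).fderiv⟩
  refine ⟨φ.source ∩ φ ⁻¹' Metric.ball (φ x) r,
    (continuousOn_extChartAt x).isOpen_inter_preimage (isOpen_chart_source x) Metric.isOpen_ball,
    ⟨hxs, Metric.mem_ball_self hr⟩, fun y hy => ?_, fun y => g (φ y), fun y hy => ?_,
    fun y hy => ?_⟩
  · have := (hball hy.2).2
    rwa [mem_preimage, φ.left_inv hy.1] at this
  · exact ((hgs'.contDiffAt (Metric.isOpen_ball.mem_nhds hy.2)).contMDiffAt.comp y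
      (contMDiffAt_chart hy.1)).contMDiffWithinAt
  · ext w
    rw [differential_comp_chart hy.1 (hg _ hy.2).differentiableAt, (hg _ hy.2).fderiv]
    exact ((hθφ hy.1 _).trans (congrArg (α y) (coordField_mfderiv_chart hy.1 w))).symm

end ExteriorDerivative

/-! ### Common symmetries versus common conservation laws. -/

section Correspondence

variable {n : ℕ} {X : Type*} [TopologicalSpace X] [ChartedSpace (EuclideanSpace ℝ (Fin n)) X]
  [IsManifold (𝓡 n) ∞ X] {K : Fin n → OpField n X} {U : Set X}

/-- `∑ h j • K j` is a common symmetry iff the differentials of its coefficients satisfy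
`K i ^* dh k = ∑ j, a_{ij}^k dh j`. -/
lemma isCommonSymmetryOn_combination_iff (hK : IsOperatorFrobeniusAlgebra K)
    (hsym : MutualSymmetriesOn univ K) (hU : IsOpen U) {h : Fin n → X → ℝ}
    (hh : ∀ i, SmoothFunOn n U (h i)) :
    IsCommonSymmetryOn U K (combination h K) ↔ ∀ x ∈ U, ∀ i k,
      (differential n (h k) x).comp (K i x) =
        ∑ j, structureFun K i j x k • differential n (h j) x := by
  have hKU (i : Fin n) : SmoothOpFieldOn U (K i) := (hK.smooth i).mono (subset_univ U)
  have hcomm (i : Fin n) (x : X) :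
      (K i x).comp (combination h K x) = (combination h K x).comp (K i x) := by
    ext v
    have e (j : Fin n) : K i x (K j x v) = K j x (K i x v) :=
      congrArg (fun C : TangentSpace (𝓡 n) x →L[ℝ] TangentSpace (𝓡 n) x => C v) (hK.commute i j x)
    simp [combination, e]
  have hKK (i j : Fin n) (x : X) (v : TangentSpace (𝓡 n) x) :
      K i x (K j x v) = ∑ k, structureFun K i j x k • K k x v := by
    have := congrArg (fun C : TangentSpace (𝓡 n) x →L[ℝ] TangentSpace (𝓡 n) x => C v)
      (comp_eq_sum_structureFun hK x i j)
    simpa using this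
  have formula (i : Fin n) {V : Set X} (hV : IsOpen V) (hVU : V ⊆ U) {ξ : VField n X}
      (hξ : SmoothVFieldOn V ξ) {x : X} (hx : x ∈ V) :
      bracketTensor (K i) (combination h K) ξ ξ x =
        ∑ k, (((differential n (h k) x).comp (K i x) -
          ∑ j, structureFun K i j x k • differential n (h j) x :
            TangentSpace (𝓡 n) x →L[ℝ] ℝ)) (ξ x) • K k x (ξ x) := by
    rw [bracketTensor_combination_of_isSymmetryOn (hsym i) hV (subset_univ V)
      (fun j => (hh j).mono hVU) hξ hx]
    simp only [hKK, sub_apply, ContinuousLinearMap.comp_apply, sum_apply,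
      smul_apply, smul_eq_mul, sub_smul, Finset.sum_sub_distrib, Finset.sum_smul, Finset.smul_sum,
      smul_smul]
    congr 1
    rw [Finset.sum_comm]
    exact Finset.sum_congr rfl fun k _ => Finset.sum_congr rfl fun j _ => by rw [mul_comm]
  constructor
  · intro hcs x hx i k
    obtain ⟨ζ, hζ⟩ := hK.exists_generic_vector x
    rw [← sub_eq_zero]
    refine forms_eq_zero_of_sum_smul_apply_eq_zero hζ (φ := fun k =>
      (differential n (h k) x).comp (K i x) -
        ∑ j, structureFun K i j x k • differential n (h j) x) (fun v => ?_) k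
    obtain ⟨V, hV, hxV, hVU, ξ, hξ, rfl⟩ := exists_smoothVField_eq hU hx v
    rw [← formula i hV hVU hξ hxV]
    exact (hcs i).bracketTensor_self hV hVU hξ hxV
  · intro H i
    refine (isSymmetryOn_iff (hKU i) (smoothOpFieldOn_combination hh hKU)
      fun x _ => hcomm i x).2 fun V hV hVU ξ hξ x hx => ?_
    rw [formula i hV hVU hξ hx]
    refine Finset.sum_eq_zero fun k _ => ?_
    rw [H x (hVU hx) i k, sub_self, zero_apply, zero_smul]

lemma isCommonSymmetryOn_combination_iff_dual (hK : IsOperatorFrobeniusAlgebra K)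
    (hsym : MutualSymmetriesOn univ K) {a : Fin n → ℝ} (ha : ∀ x, (frobeniusForm K a x).det ≠ 0)
    (hU : IsOpen U) {h : Fin n → X → ℝ} (hh : ∀ i, SmoothFunOn n U (h i)) :
    IsCommonSymmetryOn U K (combination h K) ↔ ∀ i, ∀ x ∈ U,
      pullForm (dualBasis K a i) (differential n (fun y => ∑ s, a s * h s y)) x =
        differential n (h i) x := by
  rw [isCommonSymmetryOn_combination_iff hK hsym hU hh]
  have key (x : X) (hx : x ∈ U) : (∀ i k, (differential n (h k) x).comp (K i x) =
        ∑ j, structureFun K i j x k • differential n (h j) x) ↔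
      ∀ i, pullForm (dualBasis K a i) (differential n (fun y => ∑ s, a s * h s y)) x =
        differential n (h i) x := by
    obtain ⟨ζ, hζ⟩ := hK.exists_generic_vector x
    have h1 : ∀ i, pullForm (dualBasis K a i) (differential n (fun y => ∑ s, a s * h s y)) x =
        (∑ s, a s • differential n (h s) x).comp (dualBasis K a i x) := fun i => by
      rw [pullForm, differential_linearCombination a fun i => (hh i).mdifferentiableAt hU hx]
    simp only [h1]
    exact comp_eq_sum_iff_dual (comp_eq_sum_structureFun hK x) (fun i j => hK.commute i j x) hζ
      (frobeniusForm_apply K a x) (ha x) (D := fun i => dualBasis K a i x) (fun _ => rfl)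
  exact ⟨fun H i x hx => (key x hx).1 (H x hx) i, fun H x hx => (key x hx).2 fun i => H i x hx⟩

omit [IsManifold (𝓡 n) ∞ X] in
lemma smoothFunOn_linearCombination (a : Fin n → ℝ) {h : Fin n → X → ℝ}
    (hh : ∀ i, SmoothFunOn n U (h i)) : SmoothFunOn n U (fun x => ∑ s, a s * h s x) :=
  contMDiffOn_finsetSum fun s _ => ContMDiffOn.mul contMDiffOn_const (hh s)

lemma isCommonConservationLawOn_of_pullForm_eq {M : Fin n → OpField n X} {f : X → ℝ}
    (hf : SmoothFunOn n U f) {h : Fin n → X → ℝ} (hh : ∀ i, SmoothFunOn n U (h i))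
    (H : ∀ i, ∀ x ∈ U, pullForm (M i) (differential n f) x = differential n (h i) x) :
    IsCommonConservationLawOn U M (differential n f) := fun i =>
  ⟨isClosedFormOn_differential hf,
    (isClosedFormOn_differential (hh i)).congr fun x hx => (H i x hx).symm⟩

lemma isCommonConservationLawOn_of_local {M : Fin n → OpField n X} {α : OneForm n X}
    (H : ∀ x ∈ U, ∃ V : Set X, IsOpen V ∧ x ∈ V ∧ IsCommonConservationLawOn V M α) :
    IsCommonConservationLawOn U M α := fun i =>
  ⟨isClosedFormOn_of_local fun x hx => by
      obtain ⟨V, hV, hxV, h⟩ := H x hx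
      exact ⟨V, hV, hxV, (h i).1⟩,
    isClosedFormOn_of_local fun x hx => by
      obtain ⟨V, hV, hxV, h⟩ := H x hx
      exact ⟨V, hV, hxV, (h i).2⟩⟩

/-- Finitely many closed forms `M i ^* df` have potentials on a common neighbourhood. -/
lemma IsCommonConservationLawOn.exists_potentials {M : Fin n → OpField n X}
    (hM : ∀ i, SmoothOpFieldOn U (M i)) (hU : IsOpen U) {f : X → ℝ} (hf : SmoothFunOn n U f)
    (H : IsCommonConservationLawOn U M (differential n f)) {x : X} (hx : x ∈ U) :
    ∃ V : Set X, IsOpen V ∧ x ∈ V ∧ V ⊆ U ∧ ∃ h : Fin n → X → ℝ, (∀ i, SmoothFunOn n V (h i)) ∧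
      ∀ i, ∀ y ∈ V, pullForm (M i) (differential n f) y = differential n (h i) y := by
  have h1 (i : Fin n) := (H i).2.exists_differential_eq hU (fun V hV hVU ξ hξ =>
    (hf.mono hVU).differential_apply hV (((hM i).mono hVU).applyOp hξ)) hx
  choose V hV hxV hVU h hh heq using h1
  refine ⟨U ∩ ⋂ i, V i, hU.inter (isOpen_iInter_of_finite hV), ⟨hx, mem_iInter.2 hxV⟩,
    inter_subset_left, h, fun i => (hh i).mono (inter_subset_right.trans (iInter_subset V i)),
    fun i y hy => heq i y (mem_iInter.1 hy.2 i)⟩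

/-- For a linear functional `a` on the algebra with non-degenerate form, `∑ h j • K j` is a common
symmetry of the `K j` iff the differential of `∑ a s * h s` is a common conservation law of the
dual basis with potentials `h j`. -/
theorem isCommonSymmetryOn_combination_iff_conservationLaw (hK : IsOperatorFrobeniusAlgebra K)
    (hsym : MutualSymmetriesOn univ K) {a : Fin n → ℝ} (ha : ∀ x, (frobeniusForm K a x).det ≠ 0)
    (hU : IsOpen U) {h : Fin n → X → ℝ} (hh : ∀ i, SmoothFunOn n U (h i)) :
    IsCommonSymmetryOn U K (combination h K) ↔
      IsCommonConservationLawOn U (dualBasis K a) (differential n (fun x => ∑ s, a s * h s x)) ∧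
        ∀ i, ∀ x ∈ U, pullForm (dualBasis K a i) (differential n (fun y => ∑ s, a s * h s y)) x =
          differential n (h i) x := by
  rw [isCommonSymmetryOn_combination_iff_dual hK hsym ha hU hh]
  exact ⟨fun H => ⟨isCommonConservationLawOn_of_pullForm_eq (smoothFunOn_linearCombination a hh)
    hh H, H⟩, fun H => H.2⟩

/-- Contract the equations with `a` and use `Id = ∑ a_s M^s`. -/
lemma differential_eq_of_pullForm_dualBasis (hK : IsOperatorFrobeniusAlgebra K) {a : Fin n → ℝ}
    (ha : ∀ x, (frobeniusForm K a x).det ≠ 0) (hU : IsOpen U) {f : X → ℝ} {h : Fin n → X → ℝ}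
    (hh : ∀ i, SmoothFunOn n U (h i)) {x : X} (hx : x ∈ U)
    (H : ∀ i, pullForm (dualBasis K a i) (differential n f) x = differential n (h i) x) :
    differential n (fun y => ∑ s, a s * h s y) x = differential n f x := by
  obtain ⟨ζ, hζ⟩ := hK.exists_generic_vector x
  have hid := id_eq_sum_smul_dual (comp_eq_sum_structureFun hK x) (fun i j => hK.commute i j x) hζ
    (frobeniusForm_apply K a x) (ha x) (D := fun i => dualBasis K a i x) (fun _ => rfl)
    (finrank_tangentSpace x)
  rw [differential_linearCombination a fun i => (hh i).mdifferentiableAt hU hx]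
  simp only [← H, pullForm]
  ext v
  have hv : v = ∑ s, a s • dualBasis K a s x v := by
    have := congrArg (fun C : TangentSpace (𝓡 n) x →L[ℝ] TangentSpace (𝓡 n) x => C v) hid
    simpa using this
  conv_rhs => rw [hv]
  simp

/-- The Poincaré lemma supplies potentials of the forms `M^{i*} df`, and their combination with
weights `a` has differential `df`, so the pointwise criterion for symmetries applies. Backwards,
closedness is local. -/
theorem isCommonConservationLawOn_dualBasis_iff (hK : IsOperatorFrobeniusAlgebra K)
    (hsym : MutualSymmetriesOn univ K) {a : Fin n → ℝ} (ha : ∀ x, (frobeniusForm K a x).det ≠ 0)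
    (hU : IsOpen U) {f : X → ℝ} (hf : SmoothFunOn n U f) :
    IsCommonConservationLawOn U (dualBasis K a) (differential n f) ↔
      ∀ x ∈ U, ∃ V : Set X, IsOpen V ∧ x ∈ V ∧ V ⊆ U ∧ ∃ h : Fin n → X → ℝ,
        (∀ i, SmoothFunOn n V (h i)) ∧
        (∀ y ∈ V, differential n (fun z => ∑ s, a s * h s z) y = differential n f y) ∧
        (∀ i, ∀ y ∈ V, pullForm (dualBasis K a i) (differential n f) y =
          differential n (h i) y) ∧
        IsCommonSymmetryOn V K (combination h K) := by
  constructor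
  · intro H x hx
    obtain ⟨V, hV, hxV, hVU, h, hh, heq⟩ := H.exists_potentials
      (fun i => (smoothOpFieldOn_dualBasis hK ha i).mono (subset_univ U)) hU hf hx
    have hd : ∀ y ∈ V, differential n (fun z => ∑ s, a s * h s z) y = differential n f y :=
      fun y hy => differential_eq_of_pullForm_dualBasis hK ha hV hh hy fun i => heq i y hy
    refine ⟨V, hV, hxV, hVU, h, hh, hd, heq, ?_⟩
    rw [isCommonSymmetryOn_combination_iff_dual hK hsym ha hV hh]
    intro i y hy
    rw [← heq i y hy, pullForm, pullForm, hd y hy]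
  · intro H
    refine isCommonConservationLawOn_of_local fun x hx => ?_
    obtain ⟨V, hV, hxV, hVU, h, hh, -, heq, -⟩ := H x hx
    exact ⟨V, hV, hxV, isCommonConservationLawOn_of_pullForm_eq (hf.mono hVU) hh heq⟩

end Correspondence

/-! ### The dual of the dual basis. -/

section Duality

variable {n : ℕ} {X : Type*} [TopologicalSpace X] [ChartedSpace (EuclideanSpace ℝ (Fin n)) X]
  [IsManifold (𝓡 n) ∞ X] {K : Fin n → OpField n X} (hK : IsOperatorFrobeniusAlgebra K)
  {a : Fin n → ℝ} (ha : ∀ x, (frobeniusForm K a x).det ≠ 0)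
include hK ha

lemma isOperatorFrobeniusAlgebra_dualBasis : IsOperatorFrobeniusAlgebra (dualBasis K a) where
  smooth := smoothOpFieldOn_dualBasis hK ha
  commute i j x := dualBasis_commute hK i j x
  exists_generic_vector x := by
    obtain ⟨ξ, hξ⟩ := hK.exists_generic_vector x
    exact ⟨ξ, linearIndependent_dual (ha x) hξ fun i => by simp [dualBasis]⟩
  exists_generic_covector x := by
    obtain ⟨α, hα⟩ := hK.exists_generic_covector x
    refine ⟨α, linearIndependent_dual (ha x) hα fun i => ?_⟩
    ext v
    simp [dualBasis]

variable {β : Fin n → ℝ}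
  (hβ : ∀ x : X, ContinuousLinearMap.id ℝ (TangentSpace (𝓡 n) x) = ∑ i, β i • K i x)
include hβ

/-- The functional with values `β` on the `M^i` takes the value `b^{ij}` on `M^i M^j`, since `β`
holds the coefficients of the identity in the basis `K_i`. -/
lemma frobeniusForm_dualBasis (x : X) :
    frobeniusForm (dualBasis K a) β x = (frobeniusForm K a x)⁻¹ := by
  obtain ⟨ξ, hξ⟩ := hK.exists_generic_vector x
  ext i j
  rw [frobeniusForm_apply]
  exact sum_dual_structureConstants (comp_eq_sum_structureFun hK x) (fun i j => hK.commute i j x) hξ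
    (frobeniusForm_apply K a x) (ha x) (D := fun i => dualBasis K a i x) (fun _ => rfl) (hβ x)
    (d := fun i j => structureFun (dualBasis K a) i j x)
    (comp_eq_sum_structureFun (isOperatorFrobeniusAlgebra_dualBasis hK ha) x) i j

lemma det_frobeniusForm_dualBasis_ne_zero (x : X) :
    (frobeniusForm (dualBasis K a) β x).det ≠ 0 := by
  rw [frobeniusForm_dualBasis hK ha hβ, Matrix.det_nonsing_inv]
  simpa using ha x

lemma dualBasis_dualBasis : dualBasis (dualBasis K a) β = K := by
  funext i x
  rw [dualBasis, frobeniusForm_dualBasis hK ha hβ,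
    Matrix.nonsing_inv_nonsing_inv _ (isUnit_iff_ne_zero.2 (ha x))]
  exact sum_smul_dual (ha x) (D := fun i => dualBasis K a i x) (fun _ => rfl) i

end Duality

end OperatorFrobenius

/-! ### The three statements together. -/

theorem theorem2 {n : ℕ} {X : Type*} [TopologicalSpace X]
    [ChartedSpace (EuclideanSpace ℝ (Fin n)) X] [IsManifold (𝓡 n) ∞ X]
    (K : Fin n → OpField n X) (hK : IsOperatorFrobeniusAlgebra K)
    (a : Fin n → ℝ) (ha : ∀ x, (frobeniusForm K a x).det ≠ 0)
    (M : Fin n → OpField n X) (hM : M = dualBasis K a)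
    (hsym : MutualSymmetriesOn univ K) :
    -- (1)
    MutualSymmetriesOn univ M ∧
    -- (2)
    (∀ U : Set X, IsOpen U →
      -- the equivalence for given coefficients `h^1, …, h^n`, with `h = ∑ a_s h^s`
      (∀ h : Fin n → X → ℝ, (∀ i, SmoothFunOn n U (h i)) →
        (IsCommonSymmetryOn U K (combination h K) ↔
          IsCommonConservationLawOn U M (differential n (fun x => ∑ s, a s * h s x)) ∧
            ∀ i, ∀ x ∈ U, pullForm (M i) (differential n (fun y => ∑ s, a s * h s y)) x =
              differential n (h i) x)) ∧
      -- the common conservation laws of the `M^i` are exactly the forms that arise so, locally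
      (∀ f : X → ℝ, SmoothFunOn n U f →
        (IsCommonConservationLawOn U M (differential n f) ↔
          ∀ x ∈ U, ∃ V : Set X, IsOpen V ∧ x ∈ V ∧ V ⊆ U ∧ ∃ h : Fin n → X → ℝ,
            (∀ i, SmoothFunOn n V (h i)) ∧
            (∀ y ∈ V, differential n (fun z => ∑ s, a s * h s z) y = differential n f y) ∧
            (∀ i, ∀ y ∈ V, pullForm (M i) (differential n f) y = differential n (h i) y) ∧
            IsCommonSymmetryOn V K (combination h K)))) ∧
    -- (3)
    (∀ β : Fin n → ℝ,
      (∀ x : X, ContinuousLinearMap.id ℝ (TangentSpace (𝓡 n) x) = ∑ i, β i • K i x) →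
      ∀ U : Set X, IsOpen U →
        -- `d f` is a common conservation law iff locally `K_i^* d f = d f_i` has a solution that
        -- gives a common symmetry
        (∀ f : X → ℝ, SmoothFunOn n U f →
          (IsCommonConservationLawOn U K (differential n f) ↔
            ∀ x ∈ U, ∃ V : Set X, IsOpen V ∧ x ∈ V ∧ V ⊆ U ∧ ∃ F : Fin n → X → ℝ,
              (∀ i, SmoothFunOn n V (F i)) ∧
              (∀ i, ∀ y ∈ V, pullForm (K i) (differential n f) y = differential n (F i) y) ∧
              IsCommonSymmetryOn V M (combination F M))) ∧
        -- every solution of `K_i^* d f = d f_i` gives a common symmetry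
        (∀ f : X → ℝ, SmoothFunOn n U f →
          ∀ F : Fin n → X → ℝ, (∀ i, SmoothFunOn n U (F i)) →
            (∀ i, ∀ y ∈ U, pullForm (K i) (differential n f) y = differential n (F i) y) →
            IsCommonSymmetryOn U M (combination F M)) ∧
        -- every common symmetry `∑ f_i M^i` arises so, with `f = ∑ β^s f_s`
        (∀ F : Fin n → X → ℝ, (∀ i, SmoothFunOn n U (F i)) →
          IsCommonSymmetryOn U M (combination F M) →
          IsCommonConservationLawOn U K (differential n (fun x => ∑ s, β s * F s x)) ∧
            ∀ i, ∀ y ∈ U, pullForm (K i) (differential n (fun x => ∑ s, β s * F s x)) y =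
              differential n (F i) y)) := by
  subst hM
  have hsymM := mutualSymmetriesOn_dualBasis hK hsym ha
  refine ⟨hsymM, fun U hU =>
    ⟨fun h hh => isCommonSymmetryOn_combination_iff_conservationLaw hK hsym ha hU hh,
      fun f hf => isCommonConservationLawOn_dualBasis_iff hK hsym ha hU hf⟩, fun β hβ U hU => ?_⟩
  -- The pair `(M, β)` satisfies all hypotheses made on `(K, a)`, and its dual basis is `K`;
  -- statement (3) is the correspondence for this pair.
  have hKM := isOperatorFrobeniusAlgebra_dualBasis hK ha
  have hdet := det_frobeniusForm_dualBasis_ne_zero hK ha hβ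
  have hdual := dualBasis_dualBasis hK ha hβ
  refine ⟨fun f hf => ?_, fun f hf F hF H => ?_, fun F hF H => ?_⟩
  · have h := isCommonConservationLawOn_dualBasis_iff hKM hsymM hdet hU hf
    rw [hdual] at h
    refine ⟨fun H x hx => ?_, fun H => isCommonConservationLawOn_of_local fun x hx => ?_⟩
    · obtain ⟨V, hV, hxV, hVU, F, hF, -, heq, hcs⟩ := h.1 H x hx
      exact ⟨V, hV, hxV, hVU, F, hF, heq, hcs⟩
    · obtain ⟨V, hV, hxV, hVU, F, hF, heq, -⟩ := H x hx
      exact ⟨V, hV, hxV, isCommonConservationLawOn_of_pullForm_eq (hf.mono hVU) hF heq⟩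
  · rw [isCommonSymmetryOn_combination_iff_dual hKM hsymM hdet hU hF, hdual]
    intro i x hx
    have hd : differential n (fun y => ∑ s, β s * F s y) x = differential n f x :=
      differential_eq_of_pullForm_dualBasis hKM hdet hU hF hx fun i => by
        rw [hdual]; exact H i x hx
    rw [← H i x hx, pullForm, pullForm, hd]
  · have h := (isCommonSymmetryOn_combination_iff_conservationLaw hKM hsymM hdet hU hF).1 H
    rwa [hdual] at h
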